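/- Let $k$ be a field and let $A=\{A_\alpha\}_{\alpha\in\mathcal I}$ be a profinite $k$-algebra: an inverse system, indexed by a nonempty directed preordered set $\mathcal I$, of finite-dimensional associative unital $k$-algebras with surjective transition maps $A_\beta\to A_\alpha$ ($\alpha\le\beta$). Write $A$ also for $\varprojlim A_\alpha$, put $I_\alpha=\ker(A\to A_\alpha)$ and $A^e=A\otimes_k A^{\mathrm{op}}$, and regard $A$-bimodules (on which $k$ acts centrally) as $A^e$-modules. An $A$-bimodule $B$ is *rational* if each $b\in B$ generates a (finite-dimensional) sub-bimodule isomorphic to a quotient of some $A_\alpha\otimes_k A_\alpha^{\mathrm{op}}$. Rational bimodules form an abelian category with enough injectives; for $n\ge 0$ the *continuous Hochschild cohomology* $H^n_{\mathrm{ctn}}(A,-)$ is the $n$-th right derived functor, on this category, of $$B\mapsto \operatorname{Hom}_{A^e}(A,B)\cong\{b\in B: ab=ba\text{ for all }a\in A\},$$ with values in $k$-vector spaces. For a $k$-algebra $R$ and an $R$-bimodule $M$ let $C^*(R,M)$ be the Hochschild cochain complex: $C^n(R,M)$ is the space of $k$-multilinear maps $f:R^n\to M$, with $$(df)(a_0,\dots,a_n)=a_0f(a_1,\dots,a_n)+\sum_{j=0}^{n-1}(-1)^{j+1}f(\dots,a_ja_{j+1},\dots)+(-1)^{n+1}f(a_0,\dots,a_{n-1})a_n,$$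 and $H^n(R,M)$ its cohomology. For $B$ rational let $C^*_{\mathrm{ctn}}(A,B)\subseteq C^*(A,B)$ be the subcomplex of *continuous* cochains, i.e. those $f:A^n\to B$ that factor through $A^n\to A_\alpha^n$ for some $\alpha$ as a multilinear map $A_\alpha^n\to B$, and let $B^\alpha=\{b\in B: I_\alpha b=bI_\alpha=0\}$, an $A_\alpha$-bimodule. **Theorem.** For every $n\ge 0$ there is an isomorphism, natural in the rational bimodule $B$, $$H^n_{\mathrm{ctn}}(A,B)\;\cong\;H^n\bigl(C^*_{\mathrm{ctn}}(A,B)\bigr).$$ Moreover, for every rational $B$, this isomorphism together with the maps $H^n(A_\alpha,B^\alpha)\to H^n(C^*_{\mathrm{ctn}}(A,B))$ induced by $f\mapsto(A^n\to A_\alpha^n\xrightarrow{f}B^\alpha\subseteq B)$ exhibits $$H^n_{\mathrm{ctn}}(A,B)\;\cong\;\varinjlim_{\alpha}H^n(A_\alpha,B^\alpha),$$ where for $\alpha\le\beta$ the transition map is induced by $f\mapsto (A_\beta^n\to A_\alpha^n\xrightarrow{f}B^\alpha\subseteq B^\beta)$. -/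

import Mathlib

open CategoryTheory Limits
open scoped TensorProduct ModuleCat

universe u

section Hochschild

/-- The enveloping algebra `R^e = R ⊗ R^op`, so that `R`-bimodules are left `R^e`-modules. -/
abbrev EnvAlg (k R : Type u) [Field k] [Ring R] [Algebra k R] : Type u := R ⊗[k] Rᵐᵒᵖ

variable (k : Type u) [Field k]
variable {R : Type u} [Ring R] [Algebra k R]
variable {M : Type u} [AddCommGroup M] [Module k M] [Module (EnvAlg k R) M]
  [IsScalarTower k (EnvAlg k R) M]

/-- `m ↦ r m`. -/
def bimodLeft (r : R) : M →ₗ[k] M :=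
  Algebra.lsmul k k M (r ⊗ₜ[k] 1 : EnvAlg k R)

/-- `m ↦ m r`. -/
def bimodRight (r : R) : M →ₗ[k] M :=
  Algebra.lsmul k k M (1 ⊗ₜ[k] MulOpposite.op r : EnvAlg k R)

theorem bimodLeft_apply (r : R) (m : M) :
    bimodLeft k r m = (r ⊗ₜ[k] 1 : EnvAlg k R) • m := rfl

theorem bimodRight_apply (r : R) (m : M) :
    bimodRight k r m = (1 ⊗ₜ[k] MulOpposite.op r : EnvAlg k R) • m := rfl

theorem bimodLeft_one (m : M) : bimodLeft k (1 : R) m = m := one_smul (EnvAlg k R) m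

theorem bimodRight_one (m : M) : bimodRight k (1 : R) m = m := one_smul (EnvAlg k R) m

theorem bimodLeft_mul (r s : R) (m : M) :
    bimodLeft k (r * s) m = bimodLeft k r (bimodLeft k s m) := by
  simp [bimodLeft_apply, smul_smul]

theorem bimodRight_mul (r s : R) (m : M) :
    bimodRight k (r * s) m = bimodRight k s (bimodRight k r m) := by
  simp [bimodRight_apply, smul_smul]

theorem bimodLeft_right (r s : R) (m : M) :
    bimodLeft k r (bimodRight k s m) = bimodRight k s (bimodLeft k r m) := by
  simp [bimodLeft_apply, bimodRight_apply, smul_smul]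

theorem bimodLeft_add (r s : R) (m : M) :
    bimodLeft k (r + s) m = bimodLeft k r m + bimodLeft k s m := by
  simp [bimodLeft_apply, TensorProduct.add_tmul, add_smul]

theorem bimodRight_add (r s : R) (m : M) :
    bimodRight k (r + s) m = bimodRight k r m + bimodRight k s m := by
  simp [bimodRight_apply, TensorProduct.tmul_add, add_smul]

theorem bimodLeft_smul (c : k) (r : R) (m : M) :
    bimodLeft k (c • r) m = c • bimodLeft k r m := by
  rw [bimodLeft_apply, bimodLeft_apply, ← TensorProduct.smul_tmul', smul_assoc]

theorem bimodRight_smul (c : k) (r : R) (m : M) :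
    bimodRight k (c • r) m = c • bimodRight k r m := by
  rw [bimodRight_apply, bimodRight_apply, MulOpposite.op_smul, TensorProduct.tmul_smul, smul_assoc]

theorem contractNth_update {n : ℕ} [DecidableEq (Fin (n + 1))] [DecidableEq (Fin n)]
    (j : Fin n) (a : Fin (n + 1) → R) (i : Fin (n + 1)) :
    ∃ (p : Fin n) (L : R →ₗ[k] R), ∀ x,
      Fin.contractNth j.castSucc (· * ·) (Function.update a i x) =
        Function.update (Fin.contractNth j.castSucc (· * ·) a) p (L x) := by
  rcases lt_trichotomy (i : ℕ) j with h | h | h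
  · refine ⟨⟨i, by omega⟩, LinearMap.id, fun x => funext fun m => ?_⟩
    simp only [Fin.contractNth, Function.update_apply, Fin.ext_iff, Fin.val_castSucc,
      Fin.val_succ, LinearMap.id_apply]
    split_ifs <;> first | rfl | omega
  · refine ⟨j, LinearMap.mulRight k (a j.succ), fun x => funext fun m => ?_⟩
    simp only [Fin.contractNth, Function.update_apply, Fin.ext_iff, Fin.val_castSucc,
      Fin.val_succ, LinearMap.mulRight_apply]
    split_ifs <;> first | rfl | omega | skip
    all_goals
      rw [show m = j from Fin.ext (by omega)]
  · by_cases h' : (i : ℕ) = j + 1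
    · refine ⟨j, LinearMap.mulLeft k (a j.castSucc), fun x => funext fun m => ?_⟩
      simp only [Fin.contractNth, Function.update_apply, Fin.ext_iff, Fin.val_castSucc,
        Fin.val_succ, LinearMap.mulLeft_apply]
      split_ifs <;> first | rfl | omega | skip
      all_goals
        rw [show m = j from Fin.ext (by omega)]
    · refine ⟨⟨i - 1, by omega⟩, LinearMap.id, fun x => funext fun m => ?_⟩
      simp only [Fin.contractNth, Function.update_apply, Fin.ext_iff, Fin.val_castSucc,
        Fin.val_succ, LinearMap.id_apply]
      split_ifs <;> first | rfl | omega

variable (R M) in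
/-- Hochschild cochains: `n`-fold `k`-multilinear maps from `R` to `M`. -/
abbrev HochschildCochain (n : ℕ) : Type u := MultilinearMap k (fun _ : Fin n => R) M

/-- The cochain `a ↦ a₀ f(a₁, …, aₙ)`. -/
def hochschildFirst {n : ℕ} (f : HochschildCochain k R M n) : HochschildCochain k R M (n + 1) where
  toFun a := bimodLeft k (a 0) (f (Fin.tail a))
  map_update_add' := by
    intro inst a i x y
    obtain rfl : inst = instDecidableEqFin (n + 1) := Subsingleton.elim _ _
    induction i using Fin.cases with
    | zero => simp [bimodLeft_add]
    | succ i =>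
      have h : ∀ z, Function.update a i.succ z 0 = a 0 := fun z =>
        Function.update_of_ne (Fin.succ_ne_zero i).symm _ _
      simp [Fin.tail_update_succ, h]
  map_update_smul' := by
    intro inst a i c x
    obtain rfl : inst = instDecidableEqFin (n + 1) := Subsingleton.elim _ _
    induction i using Fin.cases with
    | zero => simp [bimodLeft_smul]
    | succ i =>
      have h : ∀ z, Function.update a i.succ z 0 = a 0 := fun z =>
        Function.update_of_ne (Fin.succ_ne_zero i).symm _ _
      simp [Fin.tail_update_succ, h]

/-- The cochain `a ↦ f(a₀, …, aⱼ aⱼ₊₁, …, aₙ)`. -/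
def hochschildMiddle {n : ℕ} (j : Fin n) (f : HochschildCochain k R M n) :
    HochschildCochain k R M (n + 1) where
  toFun a := f (Fin.contractNth j.castSucc (· * ·) a)
  map_update_add' {_} a i x y := by
    obtain ⟨p, L, h⟩ := contractNth_update k j a i
    simp [h]
  map_update_smul' {_} a i c x := by
    obtain ⟨p, L, h⟩ := contractNth_update k j a i
    simp [h]

/-- The cochain `a ↦ f(a₀, …, aₙ₋₁) aₙ`. -/
def hochschildLast {n : ℕ} (f : HochschildCochain k R M n) : HochschildCochain k R M (n + 1) where
  toFun a := bimodRight k (a (Fin.last n)) (f (Fin.init a))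
  map_update_add' := by
    intro inst a i x y
    obtain rfl : inst = instDecidableEqFin (n + 1) := Subsingleton.elim _ _
    induction i using Fin.lastCases with
    | last => simp [bimodRight_add]
    | cast i =>
      have h : ∀ z, Function.update a i.castSucc z (Fin.last n) = a (Fin.last n) := fun z =>
        Function.update_of_ne (Fin.castSucc_ne_last i).symm _ _
      simp [Fin.init_update_castSucc, h]
  map_update_smul' := by
    intro inst a i c x
    obtain rfl : inst = instDecidableEqFin (n + 1) := Subsingleton.elim _ _
    induction i using Fin.lastCases with
    | last => simp [bimodRight_smul]
    | cast i =>
      have h : ∀ z, Function.update a i.castSucc z (Fin.last n) = a (Fin.last n) := fun z =>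
        Function.update_of_ne (Fin.castSucc_ne_last i).symm _ _
      simp [Fin.init_update_castSucc, h]

variable (R M) in
/-- The Hochschild differential
`(d f)(a₀, …, aₙ) = a₀ f(a₁, …, aₙ) + ∑ⱼ (-1)^(j+1) f(…, aⱼ aⱼ₊₁, …) + (-1)^(n+1) f(a₀, …, aₙ₋₁) aₙ`. -/
def hochschildD (n : ℕ) : HochschildCochain k R M n →ₗ[k] HochschildCochain k R M (n + 1) where
  toFun f := hochschildFirst k f +
    ∑ j : Fin n, (-1 : k) ^ ((j : ℕ) + 1) • hochschildMiddle k j f +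
    (-1 : k) ^ (n + 1) • hochschildLast k f
  map_add' f g := by
    ext a
    simp [hochschildFirst, hochschildMiddle, hochschildLast, Finset.sum_add_distrib, smul_add]
    abel
  map_smul' c f := by
    ext a
    simp [hochschildFirst, hochschildMiddle, hochschildLast, Finset.smul_sum, smul_add,
      smul_comm c]

theorem hochschildD_apply {n : ℕ} (f : HochschildCochain k R M n) (a : Fin (n + 1) → R) :
    hochschildD k R M n f a = bimodLeft k (a 0) (f (Fin.tail a)) +
      ∑ j : Fin n, (-1 : k) ^ ((j : ℕ) + 1) • f (Fin.contractNth j.castSucc (· * ·) a) +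
      (-1 : k) ^ (n + 1) • bimodRight k (a (Fin.last n)) (f (Fin.init a)) := by
  simp [hochschildD, hochschildFirst, hochschildMiddle, hochschildLast]

/-- Contraction of a sequence at position `i`, an auxiliary device for `d ∘ d = 0`. -/
def seqContract (i : ℕ) (x : ℕ → R) (m : ℕ) : R :=
  if m < i then x m else if m = i then x m * x (m + 1) else x (m + 1)

theorem seqContract_comm {i j : ℕ} (h : i ≤ j) (x : ℕ → R) :
    seqContract i (seqContract (j + 1) x) = seqContract j (seqContract i x) := by
  funext m
  simp only [seqContract]
  split_ifs <;> first | rfl | omega | simp [mul_assoc]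

/-- The cochain `f` extended to the two-sided bar construction. -/
def barExtend {n : ℕ} (f : HochschildCochain k R M n) (x : ℕ → R) : M :=
  bimodLeft k (x 0) (bimodRight k (x (n + 1)) (f fun i => x (i + 1)))

theorem barExtend_d {n : ℕ} (f : HochschildCochain k R M n) (x : ℕ → R) :
    barExtend k (hochschildD k R M n f) x =
      ∑ i ∈ Finset.range (n + 2), (-1 : k) ^ i • barExtend k f (seqContract i x) := by
  rw [Finset.sum_range_succ, Finset.sum_range_succ', Finset.sum_range]
  simp only [barExtend, hochschildD_apply, map_add, map_sum, map_smul]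
  rw [add_comm (bimodLeft k (x 0) _)]
  congr 1
  · congr 1
    · refine Finset.sum_congr rfl fun j _ => ?_
      congr 1
      have e : (Fin.contractNth j.castSucc (· * ·) fun i : Fin (n + 1) => x (i + 1)) =
          fun i : Fin n => seqContract (j + 1) x (i + 1) := by
        funext m
        simp [Fin.contractNth, seqContract]
      rw [e]
      have h1 : seqContract (j + 1) x 0 = x 0 := by simp [seqContract]
      have h2 : seqContract (j + 1) x (n + 1) = x (n + 1 + 1) := by
        have := j.2
        simp only [seqContract]
        split_ifs <;> first | rfl | omega
      rw [h1, h2]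
    · simp [seqContract, bimodLeft_mul, bimodLeft_right, Fin.tail_def]
  · simp [seqContract, bimodRight_mul, Fin.init_def]

theorem alternating_sum_eq_zero (g : ℕ → ℕ → M) (hg : ∀ i j, i ≤ j → g i (j + 1) = g j i) (N : ℕ) :
    ∑ j ∈ Finset.range (N + 1), ∑ i ∈ Finset.range N, (-1 : k) ^ (j + i) • g i j = 0 := by
  induction N with
  | zero => simp
  | succ N ih =>
    rw [Finset.sum_range_succ]
    simp only [Finset.sum_range_succ _ N, Finset.sum_add_distrib] at ih ⊢
    rw [hg N N le_rfl]
    have : ∑ i ∈ Finset.range N, (-1 : k) ^ (N + 1 + i) • g i (N + 1) =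
        - ∑ i ∈ Finset.range N, (-1 : k) ^ (i + N) • g N i := by
      rw [← Finset.sum_neg_distrib]
      refine Finset.sum_congr rfl fun i hi => ?_
      rw [hg i N (Finset.mem_range.1 hi).le, ← neg_smul]
      congr 1
      ring
    rw [this, show (-1 : k) ^ (N + 1 + N) = -(-1 : k) ^ (N + N) by ring, neg_smul]
    generalize (∑ i ∈ Finset.range N, (-1 : k) ^ (i + N) • g N i) = B
    generalize (-1 : k) ^ (N + N) • g N N = D
    calc _ = _ := by abel
      _ = 0 := ih

theorem hochschildD_comp (n : ℕ) (f : HochschildCochain k R M n) :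
    hochschildD k R M (n + 1) (hochschildD k R M n f) = 0 := by
  ext a
  let x : ℕ → R := fun m => if h : m - 1 < n + 2 then (if m = 0 then 1 else a ⟨m - 1, h⟩) else 1
  have h0 : x 0 = 1 := by simp [x]
  have h1 : x (n + 2 + 1) = 1 := by simp [x]
  have h2 : (fun i : Fin (n + 2) => x (i + 1)) = a := by
    funext i
    simp [x]
  have key : barExtend k (hochschildD k R M (n + 1) (hochschildD k R M n f)) x = 0 := by
    rw [barExtend_d]
    simp only [barExtend_d, Finset.smul_sum, smul_smul, ← pow_add]
    exact alternating_sum_eq_zero k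
      (fun i j => barExtend k f (seqContract i (seqContract j x)))
      (fun i j h => by simp only [seqContract_comm h]) (n + 2)
  simpa [barExtend, h0, h1, h2, bimodLeft_one, bimodRight_one] using key

variable (R M) in
/-- The Hochschild cochain complex `C^*(R, M)`. -/
noncomputable def hochschildComplex : CochainComplex (ModuleCat.{u} k) ℕ :=
  CochainComplex.of (fun n => ModuleCat.of k (HochschildCochain k R M n))
    (fun n => ModuleCat.ofHom (hochschildD k R M n))
    (fun n => by
      ext f : 2
      exact hochschildD_comp k n f)

variable (R M) in
theorem hochschildComplex_d (n : ℕ) : (hochschildComplex k R M).d n (n + 1) =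
    ModuleCat.ofHom (hochschildD k R M n) := by
  simp [hochschildComplex]

variable {S : Type u} [Ring S] [Algebra k S]
variable {N : Type u} [AddCommGroup N] [Module k N] [Module (EnvAlg k S) N]
  [IsScalarTower k (EnvAlg k S) N]

/-- `ψ : M → N` is compatible with the bimodule structures along `φ : S → R`. -/
structure BimodCompat (φ : S →ₐ[k] R) (ψ : M →ₗ[k] N) : Prop where
  left : ∀ s m, ψ (bimodLeft k (φ s) m) = bimodLeft k s (ψ m)
  right : ∀ s m, ψ (bimodRight k (φ s) m) = bimodRight k s (ψ m)

/-- The map `f ↦ ψ ∘ f ∘ φ` on Hochschild cochains. -/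
def hochschildMap (φ : S →ₐ[k] R) (ψ : M →ₗ[k] N) (n : ℕ) :
    HochschildCochain k R M n →ₗ[k] HochschildCochain k S N n where
  toFun f := ψ.compMultilinearMap (f.compLinearMap fun _ => φ.toLinearMap)
  map_add' f g := by ext a; simp
  map_smul' c f := by ext a; simp

set_option linter.unusedSectionVars false in
theorem hochschildMap_apply (φ : S →ₐ[k] R) (ψ : M →ₗ[k] N) {n : ℕ}
    (f : HochschildCochain k R M n) (a : Fin n → S) :
    hochschildMap k φ ψ n f a = ψ (f fun i => φ (a i)) := rfl

theorem hochschildMap_d {φ : S →ₐ[k] R} {ψ : M →ₗ[k] N} (h : BimodCompat k φ ψ) {n : ℕ}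
    (f : HochschildCochain k R M n) :
    hochschildD k S N n (hochschildMap k φ ψ n f) =
      hochschildMap k φ ψ (n + 1) (hochschildD k R M n f) := by
  ext a
  simp only [hochschildMap_apply, hochschildD_apply, map_add, map_sum, map_smul, h.left, h.right]
  have h1 : ∀ j : Fin n, (Fin.contractNth j.castSucc (· * ·) fun i => φ (a i)) =
      fun i => φ (Fin.contractNth j.castSucc (· * ·) a i) := fun j =>
    (Fin.comp_contractNth (f := φ) _ _ (fun x y => map_mul φ x y) j.castSucc a).symm
  simp only [h1]
  rfl

/-- The map `f ↦ ψ ∘ f ∘ φ` of Hochschild complexes. -/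
noncomputable def hochschildComplexMap {φ : S →ₐ[k] R} {ψ : M →ₗ[k] N} (h : BimodCompat k φ ψ) :
    hochschildComplex k R M ⟶ hochschildComplex k S N :=
  CochainComplex.ofHom (fun n => ModuleCat.ofHom (hochschildMap k φ ψ n)) (fun n => by
    rw [hochschildComplex_d, hochschildComplex_d]
    ext f : 2
    exact hochschildMap_d k h f)

end Hochschild

/-- A profinite algebra over `k`: an inverse system, indexed by a nonempty directed preordered set,
of finite-dimensional `k`-algebras with surjective transition maps. -/
structure ProfiniteAlgebra (k : Type u) [Field k] where
  Index : Type u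
  [preorder : Preorder Index]
  [directed : IsDirectedOrder Index]
  [nonempty : Nonempty Index]
  obj : Index → Type u
  [ring : ∀ α, Ring (obj α)]
  [algebra : ∀ α, Algebra k (obj α)]
  [finite : ∀ α, FiniteDimensional k (obj α)]
  map : ∀ {α β : Index}, α ≤ β → (obj β →ₐ[k] obj α)
  map_self : ∀ (α : Index) (x : obj α), map (le_refl α) x = x
  map_map : ∀ {α β γ : Index} (h : α ≤ β) (h' : β ≤ γ) (x : obj γ),
    map h (map h' x) = map (h.trans h') x
  map_surjective : ∀ {α β : Index} (h : α ≤ β), Function.Surjective (map h)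

namespace ProfiniteAlgebra

attribute [instance] preorder directed nonempty ring algebra finite

variable {k : Type u} [Field k] (A : ProfiniteAlgebra k)

/-- The inverse limit of the system, as a subalgebra of the product. -/
def limitSubalgebra : Subalgebra k (∀ α, A.obj α) where
  carrier := {x | ∀ (α β : A.Index) (h : α ≤ β), A.map h (x β) = x α}
  mul_mem' hx hy α β h := by simp [hx α β h, hy α β h]
  add_mem' hx hy α β h := by simp [hx α β h, hy α β h]
  algebraMap_mem' r α β h := by simp

/-- The underlying algebra `A = lim A_α`. -/
abbrev Lim : Type u := A.limitSubalgebra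

/-- The projection `A → A_α`; its kernel is the ideal `I_α`. -/
def proj (α : A.Index) : A.Lim →ₐ[k] A.obj α :=
  (Pi.evalAlgHom k A.obj α).comp A.limitSubalgebra.val

theorem map_proj {α β : A.Index} (h : α ≤ β) (x : A.Lim) : A.map h (A.proj β x) = A.proj α x :=
  x.2 α β h

/-- The projections are surjective: pass to the direct system of linear duals and extend a
functional from a member of the system to its direct limit. -/
theorem proj_surjective (α : A.Index) : Function.Surjective (A.proj α) := by
  classical
  intro a
  let G : A.Index → Type u := fun β => Module.Dual k (A.obj β)
  let f : ∀ β γ, β ≤ γ → G β →ₗ[k] G γ := fun β γ h => (A.map h).toLinearMap.dualMap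
  have : DirectedSystem G fun i j h => f i j h :=
    { map_self := fun β x => by
        ext y
        exact congrArg x (A.map_self β y)
      map_map := fun α β γ h h' x => by
        ext y
        exact congrArg x (A.map_map h h' y) }
  let ι : ∀ β, Module.Dual k (A.obj β) →ₗ[k] Module.DirectLimit G f :=
    fun β => Module.DirectLimit.of k A.Index G f β
  have hι : LinearMap.ker (ι α) = ⊥ := by
    rw [LinearMap.ker_eq_bot']
    intro x hx
    obtain ⟨β, h, hx⟩ := Module.DirectLimit.of.zero_exact hx
    ext y
    obtain ⟨z, rfl⟩ := A.map_surjective h y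
    exact LinearMap.congr_fun hx z
  let _ : AddCommGroup (Module.DirectLimit G f) := Module.addCommMonoidToAddCommGroup k
  obtain ⟨r, hr⟩ := LinearMap.exists_leftInverse_of_injective (ι α) hι
  let Φ : Module.DirectLimit G f →ₗ[k] k := (Module.Dual.eval k (A.obj α) a).comp r
  let x : ∀ β, A.obj β := fun β => (Module.evalEquiv k (A.obj β)).symm (Φ.comp (ι β))
  have hx : ∀ β (g : Module.Dual k (A.obj β)), g (x β) = Φ (ι β g) := fun β g =>
    Module.apply_evalEquiv_symm_apply (R := k) (M := A.obj β) g (Φ.comp (ι β))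
  have hext : ∀ β (y z : A.obj β), (∀ g : Module.Dual k (A.obj β), g y = g z) → y = z :=
    fun β y z h => (Module.evalEquiv k (A.obj β)).injective (LinearMap.ext h)
  refine ⟨⟨x, fun β γ h => hext _ _ _ fun g => ?_⟩, hext _ _ _ fun g => ?_⟩
  · have h1 := hx γ (f β γ h g)
    have h2 : ι γ (f β γ h g) = ι β g := Module.DirectLimit.of_f
    rw [h2, ← hx] at h1
    exact h1
  · refine (hx α g).trans ?_
    have := LinearMap.congr_fun hr g
    simp only [LinearMap.comp_apply, LinearMap.id_apply] at this
    simp [Φ, this]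

/-- The projection `A ⊗ A^op → A_α ⊗ A_α^op`. -/
noncomputable def envProj (α : A.Index) : EnvAlg k A.Lim →ₐ[k] EnvAlg k (A.obj α) :=
  Algebra.TensorProduct.map (A.proj α) (AlgHom.op (A.proj α))

theorem op_proj_surjective (α : A.Index) : Function.Surjective (AlgHom.op (A.proj α)) := fun x => by
  obtain ⟨y, hy⟩ := A.proj_surjective α x.unop
  exact ⟨MulOpposite.op y, congrArg MulOpposite.op hy⟩

theorem envProj_surjective (α : A.Index) : Function.Surjective (A.envProj α) :=
  TensorProduct.map_surjective (A.proj_surjective α) (A.op_proj_surjective α)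

theorem envProj_eq_zero_of_le {α β : A.Index} (h : α ≤ β) {x : EnvAlg k A.Lim}
    (hx : A.envProj β x = 0) : A.envProj α x = 0 := by
  have : A.envProj α =
      (Algebra.TensorProduct.map (A.map h) (AlgHom.op (A.map h))).comp (A.envProj β) := by
    ext y
    · simp [envProj, A.map_proj h]
    · simp [envProj, A.map_proj h]
  rw [this, AlgHom.comp_apply, hx, map_zero]

/-- An `A`-bimodule `B` is rational if each `b ∈ B` generates a (finite-dimensional) sub-bimodule
isomorphic to a quotient of some `A_α ⊗ A_α^op`, i.e. equal to the image of an `A^e`-linear map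
`φ : A_α ⊗ A_α^op → B`. -/
def isRational : ObjectProperty (ModuleCat.{u} (EnvAlg k A.Lim)) := fun B =>
  ∀ b : B, ∃ (α : A.Index) (φ : EnvAlg k (A.obj α) →+ B),
    (∀ (x : EnvAlg k A.Lim) (y : EnvAlg k (A.obj α)), φ (A.envProj α x * y) = x • φ y) ∧
    Set.range φ = (Submodule.span (EnvAlg k A.Lim) {b} : Set B)

theorem isRational_iff (B : ModuleCat.{u} (EnvAlg k A.Lim)) : A.isRational B ↔
    ∀ b : B, ∃ α : A.Index, ∀ x, A.envProj α x = 0 → x • b = 0 := by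
  refine forall_congr' fun b => exists_congr fun α => ⟨?_, ?_⟩
  · rintro ⟨φ, hφ, hr⟩ x hx
    have hb : b ∈ Set.range φ := by
      rw [hr]
      exact Submodule.mem_span_singleton_self b
    obtain ⟨y, rfl⟩ := hb
    rw [← hφ, hx, zero_mul, map_zero]
  · intro h
    let t : EnvAlg k A.Lim →+ B := (LinearMap.toSpanSingleton (EnvAlg k A.Lim) B b).toAddMonoidHom
    have ht : ∀ x, t x = x • b := fun x => rfl
    have hk : (A.envProj α : EnvAlg k A.Lim →+ EnvAlg k (A.obj α)).ker ≤ t.ker :=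
      fun x hx => h x hx
    let φ : EnvAlg k (A.obj α) →+ B :=
      (A.envProj α : EnvAlg k A.Lim →+ EnvAlg k (A.obj α)).liftOfRightInverse
        (Function.surjInv (A.envProj_surjective α))
        (Function.rightInverse_surjInv (A.envProj_surjective α)) ⟨t, hk⟩
    have hφ : ∀ x, φ (A.envProj α x) = x • b := fun x =>
      AddMonoidHom.liftOfRightInverse_comp_apply _ _ _ ⟨t, hk⟩ x
    refine ⟨φ, fun x y => ?_, ?_⟩
    · obtain ⟨y, rfl⟩ := A.envProj_surjective α y
      rw [← map_mul, hφ, hφ, mul_smul]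
    · ext c
      rw [SetLike.mem_coe, Submodule.mem_span_singleton, Set.mem_range,
        (A.envProj_surjective α).exists]
      simp only [hφ]

theorem isRational_of_injective {X Y : ModuleCat.{u} (EnvAlg k A.Lim)} (f : X ⟶ Y)
    (hf : Function.Injective f.hom) (hY : A.isRational Y) : A.isRational X := by
  rw [isRational_iff] at hY ⊢
  intro b
  obtain ⟨α, hα⟩ := hY (f.hom b)
  refine ⟨α, fun x hx => hf ?_⟩
  rw [map_smul, map_zero, hα x hx]

theorem isRational_of_surjective {X Y : ModuleCat.{u} (EnvAlg k A.Lim)} (f : X ⟶ Y)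
    (hf : Function.Surjective f.hom) (hX : A.isRational X) : A.isRational Y := by
  rw [isRational_iff] at hX ⊢
  intro b
  obtain ⟨c, rfl⟩ := hf b
  obtain ⟨α, hα⟩ := hX c
  exact ⟨α, fun x hx => by rw [← map_smul, hα x hx, map_zero]⟩

instance : A.isRational.IsClosedUnderIsomorphisms where
  of_iso e h := A.isRational_of_surjective e.hom
    ((ModuleCat.epi_iff_surjective _).1 inferInstance) h

instance : A.isRational.ContainsZero where
  exists_zero := ⟨ModuleCat.of _ PUnit.{u + 1}, ModuleCat.isZero_of_subsingleton _,
    (A.isRational_iff _).2 fun _ => ⟨Classical.arbitrary _, fun _ _ => rfl⟩⟩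

instance : A.isRational.IsClosedUnderKernels where
  kernels_le := by
    rintro _ ⟨f, c, hc, hf⟩
    have : Mono c.ι := mono_of_isLimit_fork hc
    exact A.isRational_of_injective c.ι ((ModuleCat.mono_iff_injective _).1 inferInstance) hf.1

instance : A.isRational.IsClosedUnderCokernels where
  cokernels_le := by
    rintro _ ⟨f, c, hc, hf⟩
    have : Epi c.π := epi_of_isColimit_cofork hc
    exact A.isRational_of_surjective c.π ((ModuleCat.epi_iff_surjective _).1 inferInstance) hf.2

instance : A.isRational.IsClosedUnderFiniteProducts where
  isClosedUnderLimitsOfShape J _ :=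
    { limitsOfShape_le := by
        rintro X ⟨p⟩
        rw [isRational_iff]
        intro b
        have hp := fun j => (A.isRational_iff _).1 (p.prop_diag_obj j)
        choose α hα using fun j => hp j ((p.π.app j).hom b)
        obtain ⟨β, hβ⟩ := Finite.exists_le fun j : J => α ⟨j⟩
        refine ⟨β, fun x hx => Concrete.isLimit_ext _ p.isLimit _ _ fun j => ?_⟩
        have := hα j x (A.envProj_eq_zero_of_le (hβ j.as) hx)
        change (p.π.app j).hom (x • b) = (p.π.app j).hom 0
        rw [map_smul, map_zero]
        exact this }

/-- The abelian category of rational `A`-bimodules and bimodule maps. -/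
abbrev RatBimod : Type (u + 1) := A.isRational.FullSubcategory

/-- The largest rational sub-bimodule. -/
def rationalPart (B : ModuleCat.{u} (EnvAlg k A.Lim)) : Submodule (EnvAlg k A.Lim) B where
  carrier := {b | ∃ α : A.Index, ∀ x, A.envProj α x = 0 → x • b = 0}
  zero_mem' := ⟨Classical.arbitrary _, fun x _ => smul_zero x⟩
  add_mem' := by
    rintro b c ⟨α, hα⟩ ⟨β, hβ⟩
    obtain ⟨γ, h1, h2⟩ := exists_ge_ge α β
    exact ⟨γ, fun x hx => by
      rw [smul_add, hα x (A.envProj_eq_zero_of_le h1 hx), hβ x (A.envProj_eq_zero_of_le h2 hx),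
        add_zero]⟩
  smul_mem' := by
    rintro y b ⟨α, hα⟩
    exact ⟨α, fun x hx => by
      rw [smul_smul]
      exact hα _ (by rw [map_mul, hx, zero_mul])⟩

/-- The category of rational bimodules has enough injectives. -/
instance : EnoughInjectives A.RatBimod where
  presentation X := by
    let J := Injective.under X.obj
    let j : X.obj ⟶ J := Injective.ι X.obj
    have hj : Function.Injective j.hom := (ModuleCat.mono_iff_injective j).1 inferInstance
    let K : A.RatBimod := ⟨ModuleCat.of _ (A.rationalPart J), (A.isRational_iff _).2 fun b => by
      obtain ⟨α, hα⟩ := b.2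
      exact ⟨α, fun x hx => Subtype.ext (hα x hx)⟩⟩
    let ι : K.obj ⟶ J := ModuleCat.ofHom (A.rationalPart J).subtype
    have lift : ∀ (Y : A.RatBimod) (g : Y.obj ⟶ J), ∃ l : Y ⟶ K, l.hom ≫ ι = g := fun Y g => by
      refine ⟨⟨ModuleCat.ofHom (g.hom.codRestrict _ fun b => ?_)⟩, rfl⟩
      obtain ⟨α, hα⟩ := (A.isRational_iff _).1 Y.property b
      exact ⟨α, fun x hx => by rw [← map_smul, hα x hx, map_zero]⟩
    have := A.isRational.preservesMonomorphisms_ι_of_isNormalEpiCategory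
    have hι : ∀ {Y : A.RatBimod} (p q : Y ⟶ K), p.hom ≫ ι = q.hom ≫ ι → p = q := fun p q h => by
      have : Mono ι := (ModuleCat.mono_iff_injective ι).2 Subtype.val_injective
      exact A.isRational.ι.map_injective ((cancel_mono ι).1 h)
    choose l hl using lift
    refine ⟨⟨K, ⟨?_⟩, l X j, ?_⟩⟩
    · intro Y Z f g hg
      have : Mono g.hom := (inferInstance : Mono (A.isRational.ι.map g))
      refine ⟨l Z (Injective.factorThru (f.hom ≫ ι) g.hom), hι _ _ ?_⟩
      change (g.hom ≫ (l Z _).hom) ≫ ι = _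
      rw [Category.assoc, hl, Injective.comp_factorThru]
    · have : Mono ((l X j).hom ≫ ι) := by rw [hl]; infer_instance
      have : Mono (A.isRational.ι.map (l X j)) := mono_of_mono (l X j).hom ι
      exact A.isRational.ι.mono_of_mono_map this

/- The sub-bimodules `B^α`. -/

variable (B : ModuleCat.{u} (EnvAlg k A.Lim))

theorem tmul_smul_eq (r : A.Lim) (s : A.Limᵐᵒᵖ) (b : B) :
    (r ⊗ₜ[k] s : EnvAlg k A.Lim) • b = bimodLeft k r (bimodRight k s.unop b) := by
  simp [bimodLeft_apply, bimodRight_apply, smul_smul]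

/-- The sub-bimodule `B^α = {b : I_α b = b I_α = 0}`, where `I_α = ker (A → A_α)`. -/
def level (α : A.Index) : Submodule (EnvAlg k A.Lim) B where
  carrier := {b | ∀ a : A.Lim, A.proj α a = 0 → bimodLeft k a b = 0 ∧ bimodRight k a b = 0}
  zero_mem' a _ := ⟨map_zero _, map_zero _⟩
  add_mem' hb hc a ha := by
    simp [(hb a ha).1, (hb a ha).2, (hc a ha).1, (hc a ha).2]
  smul_mem' x b hb a ha := by
    induction x using TensorProduct.induction_on with
    | zero =>
      have h0 : (0 : EnvAlg k A.Lim) • b = 0 := zero_smul (EnvAlg k A.Lim) b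
      exact ⟨(congrArg _ h0).trans (map_zero _), (congrArg _ h0).trans (map_zero _)⟩
    | add x y hx hy => simp [add_smul, hx.1, hx.2, hy.1, hy.2]
    | tmul r s =>
      rw [tmul_smul_eq]
      constructor
      · rw [← bimodLeft_mul, bimodLeft_right,
          (hb (a * r) (by rw [map_mul, ha, zero_mul])).1, map_zero]
      · rw [← bimodLeft_right, ← bimodRight_mul,
          (hb (s.unop * a) (by rw [map_mul, ha, mul_zero])).2, map_zero]

theorem mem_level_iff {α : A.Index} {b : B} :
    b ∈ A.level B α ↔ ∀ x, A.envProj α x = 0 → x • b = 0 := by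
  constructor
  · intro hb x hx
    have hx' : x ∈ RingHom.ker (A.envProj α) := hx
    rw [envProj, Algebra.TensorProduct.map_ker _ _ (A.proj_surjective α)
      (A.op_proj_surjective α)] at hx'
    let K : Ideal (EnvAlg k A.Lim) := LinearMap.ker (LinearMap.toSpanSingleton (EnvAlg k A.Lim) B b)
    refine (sup_le (Ideal.map_le_iff_le_comap.2 ?_) (Ideal.map_le_iff_le_comap.2 ?_) :
      _ ≤ K) hx'
    · intro a ha
      exact (hb a ha).1
    · intro a ha
      exact (hb a.unop (congrArg MulOpposite.unop ha)).2
  · intro h a ha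
    refine ⟨h _ ?_, h _ ?_⟩
    · simp [envProj, ha]
    · simp [envProj, ha]

theorem level_mono {α β : A.Index} (h : α ≤ β) : A.level B α ≤ A.level B β := fun b hb => by
  rw [mem_level_iff] at hb ⊢
  exact fun x hx => hb x (A.envProj_eq_zero_of_le h hx)

theorem smul_eq_of_envProj_eq {α : A.Index} {x y : EnvAlg k A.Lim}
    (h : A.envProj α x = A.envProj α y) (b : A.level B α) : x • b = y • b := by
  have hb := (A.mem_level_iff B).1 b.2 (x - y) (by rw [map_sub, h, sub_self])
  rw [sub_smul, sub_eq_zero] at hb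
  exact Subtype.ext hb

noncomputable instance (α : A.Index) : SMul (EnvAlg k (A.obj α)) (A.level B α) where
  smul y b := Function.surjInv (A.envProj_surjective α) y • b

theorem envProj_smul {α : A.Index} (x : EnvAlg k A.Lim) (b : A.level B α) :
    A.envProj α x • b = x • b :=
  A.smul_eq_of_envProj_eq B (Function.surjInv_eq (A.envProj_surjective α) _) b

/-- `B^α` is an `A_α`-bimodule: `x ∈ A_α ⊗ A_α^op` acts through any lift to `A ⊗ A^op`. -/
noncomputable instance (α : A.Index) : Module (EnvAlg k (A.obj α)) (A.level B α) :=
  (A.envProj_surjective α).moduleLeft (A.envProj α).toRingHom (A.envProj_smul B)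

instance (α : A.Index) : IsScalarTower k (EnvAlg k (A.obj α)) (A.level B α) where
  smul_assoc c y b := by
    obtain ⟨x, rfl⟩ := A.envProj_surjective α y
    rw [← map_smul, envProj_smul, envProj_smul, smul_assoc]

theorem bimodLeft_level {α : A.Index} (a : A.Lim) (b : A.level B α) :
    bimodLeft k (A.proj α a) b = bimodLeft k a b := by
  rw [bimodLeft_apply, bimodLeft_apply, ← envProj_smul]
  simp [envProj]

theorem bimodRight_level {α : A.Index} (a : A.Lim) (b : A.level B α) :
    bimodRight k (A.proj α a) b = bimodRight k a b := by
  rw [bimodRight_apply, bimodRight_apply, ← envProj_smul]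
  simp [envProj]

/-- The inclusion `B^α → B`. -/
def levelSubtype (α : A.Index) : A.level B α →ₗ[k] B :=
  (A.level B α).subtype.restrictScalars k

/-- The inclusion `B^α → B^β` for `α ≤ β`. -/
def levelInclusion {α β : A.Index} (h : α ≤ β) : A.level B α →ₗ[k] A.level B β :=
  (Submodule.inclusion (A.level_mono B h)).restrictScalars k

theorem compat_levelSubtype (α : A.Index) :
    BimodCompat k (A.proj α) (A.levelSubtype B α) where
  left a b := by
    rw [bimodLeft_level]
    rfl
  right a b := by
    rw [bimodRight_level]
    rfl

theorem compat_levelInclusion {α β : A.Index} (h : α ≤ β) :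
    BimodCompat k (A.map h) (A.levelInclusion B h) where
  left a b := by
    obtain ⟨a, rfl⟩ := A.proj_surjective β a
    rw [A.map_proj, bimodLeft_level, bimodLeft_level]
    rfl
  right a b := by
    obtain ⟨a, rfl⟩ := A.proj_surjective β a
    rw [A.map_proj, bimodRight_level, bimodRight_level]
    rfl

/- Continuous cochains. -/

/-- A cochain is continuous if it factors through some `A_α × ⋯ × A_α`
(equivalently, as a map on the tensor power, through some `A_α ⊗ ⋯ ⊗ A_α`). -/
def IsContinuousCochain {n : ℕ} (f : HochschildCochain k A.Lim B n) : Prop :=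
  ∃ (α : A.Index) (g : MultilinearMap k (fun _ : Fin n => A.obj α) B),
    f = g.compLinearMap fun _ => (A.proj α).toLinearMap

variable {B}

theorem isContinuousCochain_iff {n : ℕ} (f : HochschildCochain k A.Lim B n) :
    A.IsContinuousCochain B f ↔ ∃ α : A.Index, ∀ a a' : Fin n → A.Lim,
      (∀ i, A.proj α (a i) = A.proj α (a' i)) → f a = f a' := by
  refine exists_congr fun α => ⟨?_, ?_⟩
  · rintro ⟨g, rfl⟩ a a' h
    simp [h]
  · intro h
    obtain ⟨s, hs⟩ := (A.proj α).toLinearMap.exists_rightInverse_of_surjective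
      (LinearMap.range_eq_top.2 (A.proj_surjective α))
    refine ⟨f.compLinearMap fun _ => s, ?_⟩
    ext a
    refine h _ _ fun i => ?_
    exact (LinearMap.congr_fun hs (A.proj α (a i))).symm

theorem proj_eq_of_le {α β : A.Index} (h : α ≤ β) {x y : A.Lim} (hxy : A.proj β x = A.proj β y) :
    A.proj α x = A.proj α y := by
  rw [← A.map_proj h, ← A.map_proj h, hxy]

variable (B) in
/-- The space `C^n_ctn(A, B)` of continuous cochains. -/
def ctnCochain (n : ℕ) : Submodule k (HochschildCochain k A.Lim B n) where
  carrier := {f | A.IsContinuousCochain B f}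
  zero_mem' := ⟨Classical.arbitrary _, 0, rfl⟩
  add_mem' := by
    intro f g hf hg
    simp only [Set.mem_ofPred_eq, isContinuousCochain_iff] at hf hg ⊢
    obtain ⟨α, hα⟩ := hf
    obtain ⟨β, hβ⟩ := hg
    obtain ⟨γ, h1, h2⟩ := exists_ge_ge α β
    exact ⟨γ, fun a a' h => congrArg₂ (· + ·) (hα a a' fun i => A.proj_eq_of_le h1 (h i))
      (hβ a a' fun i => A.proj_eq_of_le h2 (h i))⟩
  smul_mem' := by
    rintro c _ ⟨α, g, rfl⟩
    exact ⟨α, c • g, rfl⟩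

theorem exists_forall_mem_level (hB : A.isRational B) {n : ℕ} {f : HochschildCochain k A.Lim B n}
    (hf : A.IsContinuousCochain B f) : ∃ β, ∀ a, f a ∈ A.level B β := by
  obtain ⟨α, g, rfl⟩ := hf
  obtain ⟨s, hs⟩ := Module.Finite.fg_top (R := k) (M := PiTensorProduct k fun _ : Fin n => A.obj α)
  have hB' := (A.isRational_iff B).1 hB
  choose lev hlev using hB'
  classical
  obtain ⟨β, hβ⟩ := (s.image fun t => lev (PiTensorProduct.lift g t)).exists_le
  refine ⟨β, fun a => ?_⟩
  have key : (⊤ : Submodule k (PiTensorProduct k fun _ : Fin n => A.obj α)) ≤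
      ((A.level B β).restrictScalars k).comap (PiTensorProduct.lift g) := by
    rw [← hs, Submodule.span_le]
    intro t ht
    exact A.level_mono B (hβ _ (Finset.mem_image_of_mem _ ht))
      ((A.mem_level_iff B).2 (hlev (PiTensorProduct.lift g t)))
  have := key (x := PiTensorProduct.tprod k fun i => A.proj α (a i)) trivial
  simpa using this

theorem hochschildD_mem_ctnCochain (hB : A.isRational B) {n : ℕ}
    {f : HochschildCochain k A.Lim B n} (hf : f ∈ A.ctnCochain B n) :
    hochschildD k A.Lim B n f ∈ A.ctnCochain B (n + 1) := by
  obtain ⟨β, hβ⟩ := A.exists_forall_mem_level hB hf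
  obtain ⟨α, hα⟩ := (A.isContinuousCochain_iff f).1 hf
  obtain ⟨γ, h1, h2⟩ := exists_ge_ge α β
  refine (A.isContinuousCochain_iff _).2 ⟨γ, fun a a' h => ?_⟩
  have hα' := fun i => A.proj_eq_of_le h1 (h i)
  have hl : ∀ i b, b ∈ A.level B β → bimodLeft k (a i) b = bimodLeft k (a' i) b := fun i b hb => by
    have h := (hb (a i - a' i) (by rw [map_sub, A.proj_eq_of_le h2 (h i), sub_self])).1
    rw [eq_comm, ← sub_add_cancel (a i) (a' i), bimodLeft_add, h, zero_add]
  have hr : ∀ i b, b ∈ A.level B β → bimodRight k (a i) b = bimodRight k (a' i) b := fun i b hb => by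
    have h := (hb (a i - a' i) (by rw [map_sub, A.proj_eq_of_le h2 (h i), sub_self])).2
    rw [eq_comm, ← sub_add_cancel (a i) (a' i), bimodRight_add, h, zero_add]
  rw [hochschildD_apply, hochschildD_apply, hl _ _ (hβ _), hr _ _ (hβ _),
    hα (Fin.tail a) (Fin.tail a') (fun i => hα' _), hα (Fin.init a) (Fin.init a') (fun i => hα' _)]
  congr 2
  refine Finset.sum_congr rfl fun j _ => congrArg _ (hα _ _ fun i => ?_)
  have e : ∀ c : Fin (n + 1) → A.Lim, A.proj α (Fin.contractNth j.castSucc (· * ·) c i) =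
      Fin.contractNth j.castSucc (· * ·) (fun i => A.proj α (c i)) i := fun c =>
    congrFun (Fin.comp_contractNth (f := A.proj α) _ _ (fun x y => map_mul _ x y) j.castSucc c) i
  rw [e, e, funext hα']

/-- The complex `C^*_ctn(A, B)` of continuous cochains, for a rational bimodule `B`. -/
noncomputable def ctnComplex (B : A.RatBimod) : CochainComplex (ModuleCat.{u} k) ℕ :=
  CochainComplex.of (fun n => ModuleCat.of k (A.ctnCochain B.obj n))
    (fun n => ModuleCat.ofHom ((hochschildD k A.Lim B.obj n).restrict
      fun _ hf => A.hochschildD_mem_ctnCochain B.property hf))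
    (fun n => by
      ext f : 2
      exact Subtype.ext (hochschildD_comp k n f.1))

theorem ctnComplex_d (B : A.RatBimod) (n : ℕ) : (A.ctnComplex B).d n (n + 1) =
    ModuleCat.ofHom ((hochschildD k A.Lim B.obj n).restrict
      fun _ hf => A.hochschildD_mem_ctnCochain B.property hf) := by
  simp [ctnComplex]

/-- The underlying `k`-linear map of a morphism of bimodules. -/
def bimodHomToLinear {B B' : ModuleCat.{u} (EnvAlg k A.Lim)} (φ : B ⟶ B') : B →ₗ[k] B' :=
  φ.hom.restrictScalars k

theorem compat_bimodHom {B B' : ModuleCat.{u} (EnvAlg k A.Lim)} (φ : B ⟶ B') :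
    BimodCompat k (AlgHom.id k A.Lim) (A.bimodHomToLinear φ) where
  left _ b := map_smul φ.hom _ b
  right _ b := map_smul φ.hom _ b

theorem hochschildMap_mem_ctnCochain {B B' : ModuleCat.{u} (EnvAlg k A.Lim)} (φ : B ⟶ B') {n : ℕ}
    {f : HochschildCochain k A.Lim B n} (hf : f ∈ A.ctnCochain B n) :
    hochschildMap k (AlgHom.id k A.Lim) (A.bimodHomToLinear φ) n f ∈ A.ctnCochain B' n := by
  obtain ⟨α, g, rfl⟩ := hf
  exact ⟨α, (A.bimodHomToLinear φ).compMultilinearMap g, rfl⟩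

/-- The complex of continuous cochains, as a functor of the rational bimodule; a morphism `φ` acts
by `f ↦ φ ∘ f`. -/
noncomputable def ctnComplexFunctor : A.RatBimod ⥤ CochainComplex (ModuleCat.{u} k) ℕ where
  obj B := A.ctnComplex B
  map φ := CochainComplex.ofHom
    (fun n => ModuleCat.ofHom ((hochschildMap k (AlgHom.id k A.Lim)
      (A.bimodHomToLinear φ.hom) n).restrict fun _ hf => A.hochschildMap_mem_ctnCochain φ.hom hf))
    (fun n => by
      rw [ctnComplex_d, ctnComplex_d]
      ext f : 2
      exact Subtype.ext (hochschildMap_d k (A.compat_bimodHom φ.hom) f.1))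
  map_id B := by
    ext n f : 3
    rfl
  map_comp φ ψ := by
    ext n f : 3
    rfl

/-- The functor `B ↦ Hom_{A^e}(A, B)` on rational bimodules, with values in `k`-vector spaces. -/
noncomputable def homFunctor : A.RatBimod ⥤ ModuleCat.{u} k :=
  letI : Module (EnvAlg k A.Lim) A.Lim := instModuleTensorProductMop k A.Lim
  A.isRational.ι ⋙ (linearCoyoneda k (ModuleCat.{u} (EnvAlg k A.Lim))).obj
    (Opposite.op (ModuleCat.of (EnvAlg k A.Lim) A.Lim))

instance : A.homFunctor.Additive := by
  unfold homFunctor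
  infer_instance

/-- The continuous Hochschild cohomology `H^n_ctn(A, -)`: the `n`-th right derived functor of
`B ↦ Hom_{A^e}(A, B)` on the category of rational bimodules. -/
noncomputable def ctnCohomology (n : ℕ) : A.RatBimod ⥤ ModuleCat.{u} k :=
  A.homFunctor.rightDerived n

/-- The direct system of complexes `α ↦ C^*(A_α, B^α)`; for `α ≤ β` the transition map sends `f` to
the composite of `A_β → A_α`, `f` and `B^α ⊆ B^β`. -/
noncomputable def levelDiagram (B : A.RatBimod) :
    A.Index ⥤ CochainComplex (ModuleCat.{u} k) ℕ where
  obj α := hochschildComplex k (A.obj α) (A.level B.obj α)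
  map {α β} h := hochschildComplexMap k (A.compat_levelInclusion B.obj (leOfHom h))
  map_id α := by
    ext n f : 3
    refine MultilinearMap.ext fun a => Subtype.ext ?_
    let f' : HochschildCochain k (A.obj α) (A.level B.obj α) n := f
    exact congrArg (fun a => (f' a).1) (funext fun i => A.map_self α (a i))
  map_comp {α β γ} h h' := by
    ext n f : 3
    refine MultilinearMap.ext fun a => Subtype.ext ?_
    let f' : HochschildCochain k (A.obj α) (A.level B.obj α) n := f
    exact congrArg (fun a => (f' a).1)
      (funext fun i => (A.map_map (leOfHom h) (leOfHom h') (a i)).symm)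

/-- The natural maps `C^*(A_α, B^α) → C^*_ctn(A, B)`, sending `f` to the composite of `A → A_α`, `f`
and `B^α ⊆ B`. -/
noncomputable def levelCocone (B : A.RatBimod) : Cocone (A.levelDiagram B) where
  pt := A.ctnComplexFunctor.obj B
  ι :=
    { app := fun α => CochainComplex.ofHom
        (fun n => ModuleCat.ofHom ((hochschildMap k (A.proj α) (A.levelSubtype B.obj α) n).codRestrict
          (A.ctnCochain B.obj n) fun f => ⟨α, (A.levelSubtype B.obj α).compMultilinearMap f, rfl⟩))
        (fun n => by
          refine (congrArg _ (A.ctnComplex_d B n)).trans ?_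
          refine Eq.trans ?_ (congrArg (· ≫ _)
            (hochschildComplex_d k (A.obj α) (A.level B.obj α) n).symm)
          ext f : 2
          exact Subtype.ext (hochschildMap_d k (A.compat_levelSubtype B.obj α) f))
      naturality := fun α β h => by
        ext n f : 3
        refine Subtype.ext (MultilinearMap.ext fun a => ?_)
        let f' : HochschildCochain k (A.obj α) (A.level B.obj α) n := f
        exact congrArg (fun a => (f' a).1) (funext fun i => A.map_proj (leOfHom h) (a i)) }

end ProfiniteAlgebra

/-! The functor `F` sending `B` to its complex of continuous cochains has the three properties that
characterize derived functors. It is exact in `B` (`ctnComplexFunctor_shortExact`), because short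
exact sequences of bimodules split over `k` and composing with a linear map keeps a cochain
continuous. Its cohomology in degree zero is `G = Hom(A, -)` (`nonempty_homFunctor_iso`). Its
cohomology in positive degrees vanishes on injectives (`isZero_homology_ctnComplex`).

For the vanishing, embed `B` into the rational part of `Hom_k(A, B)`, with `(a φ b)(x) = a φ(b x)`,
by `b ↦ (x ↦ b x)`. If `g` is a cocycle, the curried cochain `a ↦ (x ↦ g(a, x))` has coboundary
`±g`, read through this embedding (`hochschildD_curryCochain`). When `B` is injective the embedding
has a retraction, and the retraction carries this primitive back to a continuous cochain with values
in `B`.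

These properties suffice (`nonempty_rightDerived_iso_homology`). For an injective resolution `I` of
`X`, the sequences `0 → Zⁿ → Iⁿ → Zⁿ⁺¹ → 0` shift dimension: `Hⁿ⁺¹(F X)`, with `X = Z⁰`, becomes
`H¹(F Zⁿ)`. Both `H¹(F Zⁿ)` and `Hⁿ⁺¹(G I)` are the cokernel of `G(Iⁿ) → G(Zⁿ⁺¹)`. Every
identification is natural in the complex, hence in `X`.

For the colimit, tensor powers of `A_α` are finite-dimensional, so a continuous cochain with
rational values lands in a single `B^β` (`exists_forall_mem_level`). Hence the continuous cochains
are the directed union of the images of the complexes `C^*(A_α, B^α)`, which embed, and homology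
commutes with directed unions (`ModuleCat.nonempty_isColimit_homology`). -/

namespace CategoryTheory

open Category

/-- Three commutative squares paste. -/
theorem comp_naturality₃ {D : Type*} [Category* D] {X₁ X₂ X₃ X₄ Y₁ Y₂ Y₃ Y₄ : D} {u₁ : X₁ ⟶ Y₁}
    {u₂ : X₂ ⟶ Y₂} {u₃ : X₃ ⟶ Y₃} {u₄ : X₄ ⟶ Y₄} {p : X₁ ⟶ X₂} {q : X₂ ⟶ X₃} {r : X₃ ⟶ X₄}
    {p' : Y₁ ⟶ Y₂} {q' : Y₂ ⟶ Y₃} {r' : Y₃ ⟶ Y₄} (h₁ : u₁ ≫ p' = p ≫ u₂)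
    (h₂ : u₂ ≫ q' = q ≫ u₃) (h₃ : u₃ ≫ r' = r ≫ u₄) :
    u₁ ≫ p' ≫ q' ≫ r' = (p ≫ q ≫ r) ≫ u₄ := by
  rw [reassoc_of% h₁, reassoc_of% h₂, h₃, assoc, assoc]

/-! ### Uniqueness of pointwise cokernels -/

section CokernelComparison

variable {E D : Type*} [Category* E] [Category* D] [Abelian D]

/-- Two functors that are pointwise cokernels of the same natural transformation are isomorphic. -/
theorem nonempty_iso_of_pointwise_cokernel {P Q X X' : E ⥤ D} (a : P ⟶ Q) (p : Q ⟶ X) (p' : Q ⟶ X')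
    (w : a ≫ p = 0) (w' : a ≫ p' = 0) (hp : ∀ K, Epi (p.app K)) (hp' : ∀ K, Epi (p'.app K))
    (h : ∀ K, (ShortComplex.mk (a.app K) (p.app K) (NatTrans.congr_app w K)).Exact)
    (h' : ∀ K, (ShortComplex.mk (a.app K) (p'.app K) (NatTrans.congr_app w' K)).Exact) :
    Nonempty (X ≅ X') := by
  have : ∀ K, Epi (ShortComplex.mk (a.app K) (p.app K) (NatTrans.congr_app w K)).g := hp
  have : ∀ K, Epi (ShortComplex.mk (a.app K) (p'.app K) (NatTrans.congr_app w' K)).g := hp'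
  have e1 : ∀ K, p.app K ≫ (h K).desc (p'.app K) (NatTrans.congr_app w' K) = p'.app K :=
    fun K => (h K).g_desc _ _
  have e2 : ∀ K, p'.app K ≫ (h' K).desc (p.app K) (NatTrans.congr_app w K) = p.app K :=
    fun K => (h' K).g_desc _ _
  refine ⟨NatIso.ofComponents (fun K =>
    { hom := (h K).desc (p'.app K) (NatTrans.congr_app w' K)
      inv := (h' K).desc (p.app K) (NatTrans.congr_app w K)
      hom_inv_id := ?_
      inv_hom_id := ?_ }) fun {K L} f => ?_⟩
  · rw [← cancel_epi (p.app K), reassoc_of% (e1 K), e2, comp_id]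
  · rw [← cancel_epi (p'.app K), reassoc_of% (e2 K), e1, comp_id]
  -- The pointwise isomorphisms are natural because this can be tested after composing with the
  -- epimorphism from `Q`, where both projections are natural.
  · rw [← cancel_epi (p.app K), ← NatTrans.naturality_assoc, e1, reassoc_of% (e1 K),
      NatTrans.naturality]

end CokernelComparison

/-! ### Dimension shifting along the cycles of a complex of injectives -/

section Cycles

variable {C : Type*} [Category* C] [Abelian C]

/-- The sequence `Zⁿ → Kⁿ → Zⁿ⁺¹`. -/
noncomputable abbrev cyclesShortComplex (K : CochainComplex C ℕ) (n : ℕ) : ShortComplex C :=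
  ShortComplex.mk (K.iCycles n) (K.toCycles n (n + 1)) (by
    rw [← cancel_mono (K.iCycles (n + 1)), assoc, K.toCycles_i, K.iCycles_d, zero_comp])

/-- Since `Zⁿ⁺¹ → Kⁿ⁺¹` is mono, the kernel of `Kⁿ → Zⁿ⁺¹` is that of the differential. Its cokernel
is the homology in degree `n + 1`, which is zero by hypothesis. -/
theorem cyclesShortComplex_shortExact (K : CochainComplex C ℕ) (n : ℕ) (hK : K.ExactAt (n + 1)) :
    (cyclesShortComplex K n).ShortExact where
  exact := by
    refine ShortComplex.exact_of_f_is_kernel _ ?_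
    exact isKernelOfComp (K.iCycles (n + 1)) _ (K.cyclesIsKernel n (n + 1) (by simp))
      (cyclesShortComplex K n).zero (K.toCycles_i n (n + 1))
  mono_f := by dsimp; infer_instance
  epi_g := by
    have h := (K.exactAt_iff_isZero_homology (n + 1)).1 hK
    refine Preadditive.epi_of_isZero_cokernel' _ (K.homologyIsCokernel n (n + 1) (by simp)) h

/-- The map induced by a map of complexes on the sequences `Zⁿ → Kⁿ → Zⁿ⁺¹`. -/
noncomputable abbrev cyclesShortComplexMap {K L : CochainComplex C ℕ} (φ : K ⟶ L) (n : ℕ) :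
    cyclesShortComplex K n ⟶ cyclesShortComplex L n where
  τ₁ := HomologicalComplex.cyclesMap φ n
  τ₂ := φ.f n
  τ₃ := HomologicalComplex.cyclesMap φ (n + 1)
  comm₂₃ := by
    rw [← cancel_mono (L.iCycles (n + 1))]
    simp

variable (C) in
/-- Complexes of injective objects that are exact in positive degrees. -/
def injectiveComplexes : ObjectProperty (CochainComplex C ℕ) := fun K =>
  (∀ n, Injective (K.X n)) ∧ ∀ n, K.ExactAt (n + 1)

variable {D : Type*} [Category* D] [Abelian D]

/-- The functor `K ↦ Hᵐ(F(Zⁿ K))`. -/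
noncomputable abbrev cyclesHomology (F : C ⥤ CochainComplex D ℕ) (m n : ℕ) :
    (injectiveComplexes C).FullSubcategory ⥤ D :=
  (injectiveComplexes C).ι ⋙ HomologicalComplex.cyclesFunctor C _ n ⋙ F ⋙
    HomologicalComplex.homologyFunctor D _ m

variable (F : C ⥤ CochainComplex D ℕ) [F.PreservesZeroMorphisms]
  (hF : ∀ S : ShortComplex C, S.ShortExact → (S.map F).ShortExact)
  (hI : ∀ (I : C) (m : ℕ), Injective I → IsZero ((F.obj I).homology (m + 1)))

/-- The connecting map `Hᵐ(F(Zⁿ⁺¹)) → Hᵐ⁺¹(F(Zⁿ))`. -/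
noncomputable def cyclesConnecting (m n : ℕ) :
    cyclesHomology F m (n + 1) ⟶ cyclesHomology F (m + 1) n where
  app K := (hF _ (cyclesShortComplex_shortExact K.obj n (K.property.2 n))).δ m (m + 1) rfl
  naturality K L φ := (HomologicalComplex.HomologySequence.δ_naturality
    (F.mapShortComplex.map (cyclesShortComplexMap φ.hom n))
    (hF _ (cyclesShortComplex_shortExact K.obj n (K.property.2 n)))
    (hF _ (cyclesShortComplex_shortExact L.obj n (L.property.2 n))) m (m + 1) rfl).symm

-- The next term of the long exact sequence is `Hᵐ⁺¹(F(Kⁿ))`, which vanishes because `Kⁿ` is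
-- injective. For `m = 0` nothing is claimed about injectivity: `H⁰(F(Kⁿ))` need not vanish.
include hI in
theorem epi_cyclesConnecting (m n : ℕ) (K : (injectiveComplexes C).FullSubcategory) :
    Epi ((cyclesConnecting F hF m n).app K) :=
  ShortComplex.ShortExact.epi_δ _ _ _ _ (hI _ _ (K.property.1 n))

-- Each connecting map trades one step along the cycles for one cohomological degree. Starting in
-- degree `m + 1` keeps both neighbouring groups `H(F(Kⁿ))` in positive degrees, so the connecting
-- maps are isomorphisms and not merely epimorphisms.
include hF hI in
theorem nonempty_cyclesHomology_iso (m n : ℕ) :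
    Nonempty (cyclesHomology F (m + 1) n ≅ cyclesHomology F (m + n + 1) 0) := by
  induction n generalizing m with
  | zero => exact ⟨Iso.refl _⟩
  | succ n ih =>
    have : ∀ K, IsIso ((cyclesConnecting F hF (m + 1) n).app K) := fun K =>
      ShortComplex.ShortExact.isIso_δ _ _ _ _ (hI _ _ (K.property.1 n)) (hI _ _ (K.property.1 n))
    have := NatIso.isIso_of_isIso_app (cyclesConnecting F hF (m + 1) n)
    obtain ⟨e⟩ := ih (m + 1)
    rw [show m + (n + 1) + 1 = m + 1 + n + 1 by omega]
    exact ⟨asIso (cyclesConnecting F hF (m + 1) n) ≪≫ e⟩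

/-! ### Comparison with right derived functors -/

section Derived

variable (G : C ⥤ D) [G.Additive]

/-- The functor `K ↦ Hⁿ(G(K))`. -/
noncomputable abbrev mapHomology (n : ℕ) : (injectiveComplexes C).FullSubcategory ⥤ D :=
  (injectiveComplexes C).ι ⋙ G.mapHomologicalComplex _ ⋙ HomologicalComplex.homologyFunctor D _ n

section Comparison

variable {K K' : CochainComplex C ℕ} {L L' : CochainComplex D ℕ}

/-- The map `G(Zⁿ K) → Zⁿ(L)` for a complex `L` with terms `G(Kⁿ)`. -/
noncomputable def mapCyclesTo (θ : ∀ i, G.obj (K.X i) ≅ L.X i)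
    (hθ : ∀ i j, (θ i).hom ≫ L.d i j = G.map (K.d i j) ≫ (θ j).hom) (n : ℕ) :
    G.obj (K.cycles n) ⟶ L.cycles n :=
  L.liftCycles (G.map (K.iCycles n) ≫ (θ n).hom) (n + 1) (by simp) (by
    rw [assoc, hθ, ← G.map_comp_assoc, K.iCycles_d, G.map_zero, zero_comp])

variable (θ : ∀ i, G.obj (K.X i) ≅ L.X i)
  (hθ : ∀ i j, (θ i).hom ≫ L.d i j = G.map (K.d i j) ≫ (θ j).hom)
  (θ' : ∀ i, G.obj (K'.X i) ≅ L'.X i)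
  (hθ' : ∀ i j, (θ' i).hom ≫ L'.d i j = G.map (K'.d i j) ≫ (θ' j).hom)

theorem mapCyclesTo_iCycles (n : ℕ) :
    mapCyclesTo G θ hθ n ≫ L.iCycles n = G.map (K.iCycles n) ≫ (θ n).hom :=
  HomologicalComplex.liftCycles_i _ _ _ _ _

theorem mapCyclesTo_naturality (φ : K ⟶ K') (ψ : L ⟶ L')
    (h : ∀ i, (θ i).hom ≫ ψ.f i = G.map (φ.f i) ≫ (θ' i).hom) (n : ℕ) :
    G.map (HomologicalComplex.cyclesMap φ n) ≫ mapCyclesTo G θ' hθ' n =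
      mapCyclesTo G θ hθ n ≫ HomologicalComplex.cyclesMap ψ n := by
  rw [← cancel_mono (L'.iCycles n), assoc, assoc, HomologicalComplex.cyclesMap_i,
    mapCyclesTo_iCycles, ← assoc, ← assoc, ← G.map_comp, HomologicalComplex.cyclesMap_i,
    mapCyclesTo_iCycles, assoc, h, G.map_comp, assoc]

theorem map_toCycles_mapCyclesTo (n : ℕ) :
    G.map (K.toCycles n (n + 1)) ≫ mapCyclesTo G θ hθ (n + 1) =
      (θ n).hom ≫ L.toCycles n (n + 1) := by
  rw [← cancel_mono (L.iCycles (n + 1)), assoc, mapCyclesTo_iCycles, assoc, L.toCycles_i, hθ,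
    ← assoc, ← G.map_comp, K.toCycles_i]

theorem map_toCycles_mapCyclesTo_homologyπ (n : ℕ) :
    G.map (K.toCycles n (n + 1)) ≫ mapCyclesTo G θ hθ (n + 1) ≫ L.homologyπ (n + 1) = 0 := by
  rw [← assoc, map_toCycles_mapCyclesTo, assoc, L.toCycles_comp_homologyπ, comp_zero]

variable [PreservesFiniteLimits G]

/-- A left exact `G` preserves the kernel of `Kⁿ → Kⁿ⁺¹`. The inverse is obtained by lifting the
inclusion of the cycles of `L` through that preserved kernel. -/
theorem isIso_mapCyclesTo (n : ℕ) : IsIso (mapCyclesTo G θ hθ n) := by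
  let h1 := KernelFork.mapIsLimit _ (K.cyclesIsKernel n (n + 1) (by simp)) G
  have hz : L.iCycles n ≫ (θ n).inv ≫ G.map (K.d n (n + 1)) = 0 := by
    rw [← cancel_mono (θ (n + 1)).hom, assoc, assoc, ← hθ, Iso.inv_hom_id_assoc, L.iCycles_d,
      zero_comp]
  obtain ⟨r, hr⟩ : ∃ r : L.cycles n ⟶ G.obj (K.cycles n),
      r ≫ G.map (K.iCycles n) = L.iCycles n ≫ (θ n).inv :=
    ⟨h1.lift (KernelFork.ofι (L.iCycles n ≫ (θ n).inv) ((assoc _ _ _).trans hz)),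
      h1.fac _ WalkingParallelPair.zero⟩
  refine ⟨r, ?_, ?_⟩
  · rw [← cancel_mono (G.map (K.iCycles n)), assoc, hr, ← assoc, mapCyclesTo_iCycles, assoc,
      Iso.hom_inv_id, comp_id, id_comp]
  · rw [← cancel_mono (L.iCycles n), assoc, mapCyclesTo_iCycles, ← assoc, hr, assoc,
      Iso.inv_hom_id, comp_id, id_comp]

theorem epi_mapCyclesTo_homologyπ (n : ℕ) : Epi (mapCyclesTo G θ hθ n ≫ L.homologyπ n) := by
  have := isIso_mapCyclesTo G θ hθ n
  infer_instance

/-- Through `θ` and the isomorphism `G(Zⁿ⁺¹ K) ≅ Zⁿ⁺¹(L)`, this is the defining presentation `Lⁿ →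
Zⁿ⁺¹(L) → Hⁿ⁺¹(L)` of homology as a cokernel. -/
theorem exact_mapCyclesTo_homologyπ (n : ℕ) :
    (ShortComplex.mk _ _ (map_toCycles_mapCyclesTo_homologyπ G θ hθ n)).Exact := by
  have := isIso_mapCyclesTo G θ hθ (n + 1)
  refine ShortComplex.exact_of_iso
    (S₁ := ShortComplex.mk _ _ (L.toCycles_comp_homologyπ n (n + 1)))
    (ShortComplex.isoMk (θ n).symm (asIso (mapCyclesTo G θ hθ (n + 1))).symm (Iso.refl _)
      ?_ ?_) ?_
  · dsimp
    rw [IsIso.eq_comp_inv, assoc, map_toCycles_mapCyclesTo, Iso.inv_hom_id_assoc]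
  · simp
  · exact ShortComplex.exact_of_g_is_cokernel _ (L.homologyIsCokernel n (n + 1) (by simp))

end Comparison

/-- The map `G(Zⁿ K) → Hⁿ(G(K))`. -/
noncomputable def mapCyclesToHomology (n : ℕ) :
    (injectiveComplexes C).ι ⋙ HomologicalComplex.cyclesFunctor C _ n ⋙ G ⟶ mapHomology G n where
  app K := mapCyclesTo G (L := (G.mapHomologicalComplex (ComplexShape.up ℕ)).obj K.obj)
    (fun _ => Iso.refl _) (fun _ _ => (id_comp _).trans (comp_id _).symm) n ≫
      HomologicalComplex.homologyπ _ n
  naturality _ _ φ :=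
    (assoc _ _ _).symm.trans ((congrArg (· ≫ _) (mapCyclesTo_naturality G
      (L := (G.mapHomologicalComplex (ComplexShape.up ℕ)).obj _)
      (L' := (G.mapHomologicalComplex (ComplexShape.up ℕ)).obj _)
      (fun _ => Iso.refl _) (fun _ _ => (id_comp _).trans (comp_id _).symm)
      (fun _ => Iso.refl _) (fun _ _ => (id_comp _).trans (comp_id _).symm) φ.hom
      ((G.mapHomologicalComplex (ComplexShape.up ℕ)).map φ.hom)
      (fun _ => (id_comp _).trans (comp_id _).symm) n)).trans
      ((assoc _ _ _).trans ((congrArg (_ ≫ ·)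
        (HomologicalComplex.homologyπ_naturality _ n).symm).trans (assoc _ _ _).symm)))

/-- Transport of an exact sequence along an isomorphism of its first two terms. -/
theorem exact_of_comp_iso {X₁ X₂ Y₁ Y₂ Z : D} {f : X₁ ⟶ X₂} {g : X₂ ⟶ Z} {w : f ≫ g = 0}
    (h : (ShortComplex.mk f g w).Exact) (e₁ : Y₁ ≅ X₁) (e₂ : Y₂ ≅ X₂) (f' : Y₁ ⟶ Y₂)
    (hf : f' ≫ e₂.hom = e₁.hom ≫ f) (w' : f' ≫ e₂.hom ≫ g = 0) :
    (ShortComplex.mk f' (e₂.hom ≫ g) w').Exact :=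
  ShortComplex.exact_of_iso (S₁ := ShortComplex.mk f g w)
    (S₂ := ShortComplex.mk f' (e₂.hom ≫ g) w') (ShortComplex.isoMk e₁.symm e₂.symm (Iso.refl _)
    (by dsimp; rw [Iso.inv_comp_eq, ← assoc, ← hf, assoc, Iso.hom_inv_id, comp_id])
    (by simp)) h

/-- The map `G(Kⁿ) → G(Zⁿ⁺¹ K)`. -/
noncomputable def mapToCycles (n : ℕ) :
    (injectiveComplexes C).ι ⋙ HomologicalComplex.eval C _ n ⋙ G ⟶
      (injectiveComplexes C).ι ⋙ HomologicalComplex.cyclesFunctor C _ (n + 1) ⋙ G where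
  app K := G.map (K.obj.toCycles n (n + 1))
  naturality _ _ φ := (G.map_comp _ _).symm.trans ((congrArg G.map
    (cyclesShortComplexMap φ.hom n).comm₂₃).trans (G.map_comp _ _))

variable [PreservesFiniteLimits G]

-- Both sides are cokernels of `G(Kⁿ) → G(Zⁿ⁺¹)`. For `Hⁿ⁺¹(G(K))` this is left exactness of `G`;
-- for `H¹(F(Zⁿ))` it is the start of the long exact sequence, with `G` in place of `H⁰ ∘ F` and
-- `H¹(F(Kⁿ)) = 0`.
include hF hI in
theorem nonempty_mapHomology_iso (e : G ≅ F ⋙ HomologicalComplex.homologyFunctor D _ 0) (n : ℕ) :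
    Nonempty (mapHomology G (n + 1) ≅ cyclesHomology F 1 n) := by
  let p' : (injectiveComplexes C).ι ⋙ HomologicalComplex.cyclesFunctor C _ (n + 1) ⋙ G ⟶
      cyclesHomology F 1 n :=
    Functor.whiskerLeft _ (Functor.whiskerLeft _ e.hom) ≫ cyclesConnecting F hF 0 n
  have he : ∀ K : CochainComplex C ℕ,
      G.map (K.toCycles n (n + 1)) ≫ (e.app (K.cycles (n + 1))).hom =
      (e.app (K.X n)).hom ≫ HomologicalComplex.homologyMap (F.map (K.toCycles n (n + 1))) 0 :=
    fun K => e.hom.naturality _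
  have hz : ∀ K : (injectiveComplexes C).FullSubcategory,
      G.map (K.obj.toCycles n (n + 1)) ≫ (e.app (K.obj.cycles (n + 1))).hom ≫
        (cyclesConnecting F hF 0 n).app K = 0 := fun K =>
    (assoc _ _ _).symm.trans ((congrArg (· ≫ _) (he K.obj)).trans ((assoc _ _ _).trans
      ((congrArg (_ ≫ ·) (ShortComplex.ShortExact.comp_δ
        (hF _ (cyclesShortComplex_shortExact K.obj n (K.property.2 n))) 0 1 rfl)).trans comp_zero)))
  have w : mapToCycles G n ≫ mapCyclesToHomology G (n + 1) = 0 := by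
    ext K
    exact map_toCycles_mapCyclesTo_homologyπ G _ _ n
  have w' : mapToCycles G n ≫ p' = 0 := by
    ext K
    exact hz K
  refine nonempty_iso_of_pointwise_cokernel (mapToCycles G n) (mapCyclesToHomology G (n + 1)) p'
    w w' ?_ ?_ ?_ ?_
  · intro K
    exact epi_mapCyclesTo_homologyπ G _ _ (n + 1)
  · intro K
    have := epi_cyclesConnecting F hF hI 0 n K
    exact epi_comp (e.hom.app _) ((cyclesConnecting F hF 0 n).app K)
  · intro K
    exact exact_mapCyclesTo_homologyπ G _ _ n
  · intro K
    exact exact_of_comp_iso (ShortComplex.ShortExact.homology_exact₃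
      (hF _ (cyclesShortComplex_shortExact K.obj n (K.property.2 n))) 0 1 rfl)
      (e.app (K.obj.X n)) (e.app (K.obj.cycles (n + 1))) _ (he K.obj) (hz K)

/-- An injective resolution, as a complex of injective objects exact in positive degrees. -/
abbrev InjectiveResolution.toInjectiveComplexes {X : C} (I : InjectiveResolution X) :
    (injectiveComplexes C).FullSubcategory :=
  ⟨I.cocomplex, I.injective, I.cocomplex_exactAt_succ⟩

/-- An object is the object of cycles in degree `0` of its injective resolution. -/
noncomputable def InjectiveResolution.isoCycles {X : C} (I : InjectiveResolution X) :
    X ≅ I.cocomplex.cycles 0 :=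
  I.isLimitKernelFork.conePointUniqueUpToIso (I.cocomplex.cyclesIsKernel 0 1 (by simp))

theorem InjectiveResolution.isoCycles_hom_iCycles {X : C} (I : InjectiveResolution X) :
    I.isoCycles.hom ≫ I.cocomplex.iCycles 0 = I.ι.f 0 :=
  I.isLimitKernelFork.conePointUniqueUpToIso_hom_comp _ WalkingParallelPair.zero

/-- Any `φ` lifting `f` in degree zero works; this turns naturality in the complex into naturality
in the resolved object. -/
theorem InjectiveResolution.isoCycles_hom_naturality {X Y : C} (f : X ⟶ Y)
    (I : InjectiveResolution X) (J : InjectiveResolution Y) (φ : I.cocomplex ⟶ J.cocomplex)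
    (comm : I.ι.f 0 ≫ φ.f 0 = f ≫ J.ι.f 0) :
    f ≫ J.isoCycles.hom = I.isoCycles.hom ≫ HomologicalComplex.cyclesMap φ 0 := by
  rw [← cancel_mono (J.cocomplex.iCycles 0), assoc, assoc, HomologicalComplex.cyclesMap_i,
    J.isoCycles_hom_iCycles]
  exact comm.symm.trans ((congrArg (· ≫ _) I.isoCycles_hom_iCycles.symm).trans (assoc _ _ _))

variable [HasInjectiveResolutions C]

include hF hI in
/-- A cohomology theory of complexes that is exact and vanishes on injective objects in positive
degrees computes the right derived functors of its part in degree zero. -/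
theorem nonempty_rightDerived_iso_homology
    (e : G ≅ F ⋙ HomologicalComplex.homologyFunctor D _ 0) (n : ℕ) :
    Nonempty (G.rightDerived n ≅ F ⋙ HomologicalComplex.homologyFunctor D _ n) := by
  cases n with
  -- A left exact functor is its own zeroth right derived functor.
  | zero => exact ⟨G.rightDerivedZeroIsoSelf ≪≫ e⟩
  | succ n =>
    obtain ⟨e₁⟩ := nonempty_mapHomology_iso F hF hI G e n
    obtain ⟨e₂⟩ := nonempty_cyclesHomology_iso F hF hI 0 n
    rw [Nat.zero_add n] at e₂
    -- On a resolution `I` this reads `Hⁿ⁺¹(G I) ≅ H¹(F(Zⁿ I)) ≅ Hⁿ⁺¹(F(Z⁰ I))`, and `Z⁰ I` is the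
    -- resolved object.
    let ε := e₁ ≪≫ e₂
    let H := F ⋙ HomologicalComplex.homologyFunctor D _ (n + 1)
    refine ⟨NatIso.ofComponents (fun X => (injectiveResolution X).isoRightDerivedObj G (n + 1) ≪≫
      ε.app (injectiveResolution X).toInjectiveComplexes ≪≫
        H.mapIso (injectiveResolution X).isoCycles.symm) fun {X Y} f => ?_⟩
    let φ : (injectiveResolution X).cocomplex ⟶ (injectiveResolution Y).cocomplex :=
      InjectiveResolution.desc f _ _
    have hφ : (injectiveResolution X).ι.f 0 ≫ φ.f 0 = f ≫ (injectiveResolution Y).ι.f 0 := by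
      exact InjectiveResolution.desc_commutes_zero f _ _
    let φ' : (injectiveResolution X).toInjectiveComplexes ⟶
      (injectiveResolution Y).toInjectiveComplexes := ⟨φ⟩
    have h1 := InjectiveResolution.isoRightDerivedObj_hom_naturality f _ _ φ hφ G (n + 1)
    have h2 : (mapHomology G (n + 1)).map φ' ≫ ε.hom.app _ =
      ε.hom.app _ ≫ H.map (HomologicalComplex.cyclesMap φ 0) := ε.hom.naturality φ'
    have h3 : HomologicalComplex.cyclesMap φ 0 ≫ (injectiveResolution Y).isoCycles.inv =
        (injectiveResolution X).isoCycles.inv ≫ f := by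
      refine (Iso.comp_inv_eq _).2 ?_
      rw [assoc, InjectiveResolution.isoCycles_hom_naturality f _ _ φ hφ, Iso.inv_hom_id_assoc]
    exact comp_naturality₃ h1 h2
      ((H.map_comp _ _).symm.trans ((congrArg H.map h3).trans (H.map_comp _ _)))

end Derived
end Cycles
end CategoryTheory

/-! ### Exactness of continuous cochains, and degree zero -/

namespace ProfiniteAlgebra

variable {k : Type u} [Field k] (A : ProfiniteAlgebra k)

instance : PreservesFiniteLimits A.isRational.ι := by
  have := fun {X Y : A.RatBimod} (f : X ⟶ Y) => A.isRational.preservesKernels_ι f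
  exact Functor.preservesFiniteLimits_of_preservesKernels _

instance : PreservesFiniteColimits A.isRational.ι := by
  have := fun {X Y : A.RatBimod} (f : X ⟶ Y) => A.isRational.preservesCokernels_ι f
  exact Functor.preservesFiniteColimits_of_preservesCokernels _

instance : PreservesFiniteLimits A.homFunctor := by
  let _ : Module (EnvAlg k A.Lim) A.Lim := instModuleTensorProductMop k A.Lim
  let X := Opposite.op (ModuleCat.of (EnvAlg k A.Lim) A.Lim)
  -- On underlying sets the functor is representable, hence preserves limits, and the forgetful
  -- functor from vector spaces reflects them.
  have : PreservesFiniteLimits ((linearCoyoneda k (ModuleCat.{u} (EnvAlg k A.Lim))).obj X ⋙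
      forget (ModuleCat.{u} k)) :=
    inferInstanceAs (PreservesFiniteLimits (coyoneda.obj X))
  have : PreservesFiniteLimits ((linearCoyoneda k (ModuleCat.{u} (EnvAlg k A.Lim))).obj X) :=
    ⟨fun J _ _ => preservesLimitsOfShape_of_reflects_of_preserves _ (forget (ModuleCat.{u} k))⟩
  exact comp_preservesFiniteLimits _ _

instance : A.ctnComplexFunctor.Additive where
  map_add {X Y f g} := by
    ext n c : 3
    rfl

/-- Exactness of rational bimodules is exactness of the underlying spaces. -/
theorem shortExact_underlying {S : ShortComplex A.RatBimod} (hS : S.ShortExact) :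
    Function.Injective S.f.hom.hom ∧ Function.Surjective S.g.hom.hom ∧
      ∀ x, S.g.hom.hom x = 0 → ∃ y, S.f.hom.hom y = x := by
  have h := hS.map_of_exact A.isRational.ι
  exact ⟨h.moduleCat_injective_f, h.moduleCat_surjective_g,
    (ShortComplex.moduleCat_exact_iff _).1 h.exact⟩

theorem isContinuousCochain_comp {B B' : ModuleCat.{u} (EnvAlg k A.Lim)} (ψ : B →ₗ[k] B')
    {n : ℕ} {f : HochschildCochain k A.Lim B n} (hf : A.IsContinuousCochain B f) :
    A.IsContinuousCochain B' (ψ.compMultilinearMap f) := by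
  obtain ⟨α, g, rfl⟩ := hf
  exact ⟨α, ψ.compMultilinearMap g, rfl⟩

/-- The functor of continuous cochains is exact. -/
theorem ctnComplexFunctor_shortExact (S : ShortComplex A.RatBimod) (hS : S.ShortExact) :
    (S.map A.ctnComplexFunctor).ShortExact := by
  obtain ⟨h1, h2, h3⟩ := A.shortExact_underlying hS
  refine HomologicalComplex.shortExact_of_degreewise_shortExact _ fun n => ?_
  let i := A.bimodHomToLinear S.f.hom
  let p := A.bimodHomToLinear S.g.hom
  have hi : Function.Injective i := h1
  -- The splittings `r` and `s` are only `k`-linear, so they give no chain maps; this is enough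
  -- because exactness is checked degree by degree.
  obtain ⟨r, hr⟩ := i.exists_leftInverse_of_injective (LinearMap.ker_eq_bot.2 hi)
  obtain ⟨s, hs⟩ := p.exists_rightInverse_of_surjective (LinearMap.range_eq_top.2 h2)
  have hr' : ∀ x, p x = 0 → i (r x) = x := fun x hx => by
    obtain ⟨y, rfl⟩ := h3 x hx
    exact congrArg i (LinearMap.congr_fun hr y)
  refine ModuleCat.shortComplex_shortExact _ ?_ ?_ ?_
  · intro f
    constructor
    · intro hf
      let f' : A.ctnCochain S.X₂.obj n := f
      have hf' : ∀ a, p (f'.1 a) = 0 := fun a =>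
        congrArg (fun c : A.ctnCochain S.X₃.obj n => c.1 a) hf
      refine ⟨(⟨r.compMultilinearMap f'.1, A.isContinuousCochain_comp r f'.2⟩ :
        A.ctnCochain S.X₁.obj n), ?_⟩
      exact Subtype.ext (MultilinearMap.ext fun a => hr' _ (hf' a))
    · rintro ⟨g, rfl⟩
      have h : S.f ≫ S.g = 0 := S.zero
      let g' : A.ctnCochain S.X₁.obj n := g
      refine Subtype.ext (MultilinearMap.ext fun a => ?_)
      exact congrArg (fun φ : S.X₁ ⟶ S.X₃ => φ.hom.hom (g'.1 a)) h
  · intro f g hfg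
    refine Subtype.ext (MultilinearMap.ext fun a => h1 ?_)
    exact congrArg (fun c : A.ctnCochain S.X₂.obj n => c.1 a) hfg
  · intro f
    let f' : A.ctnCochain S.X₃.obj n := f
    refine ⟨(⟨s.compMultilinearMap f'.1, A.isContinuousCochain_comp s f'.2⟩ :
      A.ctnCochain S.X₂.obj n), ?_⟩
    refine Subtype.ext (MultilinearMap.ext fun a => ?_)
    exact LinearMap.congr_fun hs (f'.1 a)

/-- A bimodule map `φ : A → B` as the cochain `φ(1)` of degree zero. -/
noncomputable def homToCochain (B : A.RatBimod) :
    A.homFunctor.obj B →ₗ[k] A.ctnCochain B.obj 0 :=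
  letI : Module (EnvAlg k A.Lim) A.Lim := instModuleTensorProductMop k A.Lim
  { toFun := fun φ => ⟨MultilinearMap.constOfIsEmpty k _
      ((show ModuleCat.of (EnvAlg k A.Lim) A.Lim ⟶ B.obj from φ).hom (1 : A.Lim)),
      (A.isContinuousCochain_iff _).2 ⟨Classical.arbitrary _, fun _ _ _ => rfl⟩⟩
    map_add' := fun _ _ => rfl
    map_smul' := fun _ _ => rfl }

/-- Together with its mirror image below, this shows that `1` generates `A` from either side, so a
bimodule map out of `A` is controlled by its value at `1`. -/
theorem tmul_one_smul_one (a : A.Lim) :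
    letI : Module (EnvAlg k A.Lim) A.Lim := instModuleTensorProductMop k A.Lim
    (a ⊗ₜ[k] 1 : EnvAlg k A.Lim) • (1 : A.Lim) = a := by
  refine (AlgHom.mulLeftRight_apply k A.Lim a 1 1).trans ?_
  simp

theorem one_tmul_smul_one (a : A.Lim) :
    letI : Module (EnvAlg k A.Lim) A.Lim := instModuleTensorProductMop k A.Lim
    (1 ⊗ₜ[k] MulOpposite.op a : EnvAlg k A.Lim) • (1 : A.Lim) = a := by
  refine (AlgHom.mulLeftRight_apply k A.Lim 1 (MulOpposite.op a) 1).trans ?_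
  simp

theorem homToCochain_injective (B : A.RatBimod) : Function.Injective (A.homToCochain B) := by
  let _ : Module (EnvAlg k A.Lim) A.Lim := instModuleTensorProductMop k A.Lim
  intro φ ψ h
  let φ' : ModuleCat.of (EnvAlg k A.Lim) A.Lim ⟶ B.obj := φ
  let ψ' : ModuleCat.of (EnvAlg k A.Lim) A.Lim ⟶ B.obj := ψ
  have h1 : φ'.hom (1 : A.Lim) = ψ'.hom (1 : A.Lim) :=
    congrArg (fun c : A.ctnCochain B.obj 0 => c.1 Fin.elim0) h
  refine ModuleCat.hom_ext (LinearMap.ext fun a : A.Lim => ?_)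
  have e := A.tmul_one_smul_one a
  calc φ'.hom a = φ'.hom ((a ⊗ₜ[k] 1 : EnvAlg k A.Lim) • (1 : A.Lim)) := by rw [e]
    _ = ψ'.hom ((a ⊗ₜ[k] 1 : EnvAlg k A.Lim) • (1 : A.Lim)) := by
      rw [map_smul, map_smul, h1]
    _ = ψ'.hom a := by rw [e]

theorem hochschildD_zero_apply {B : ModuleCat.{u} (EnvAlg k A.Lim)}
    (f : HochschildCochain k A.Lim B 0) (a : Fin 1 → A.Lim) :
    hochschildD k A.Lim B 0 f a =
      bimodLeft k (a 0) (f Fin.elim0) - bimodRight k (a 0) (f Fin.elim0) := by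
  rw [hochschildD_apply, sub_eq_add_neg, Subsingleton.elim (Fin.tail a) Fin.elim0,
    Subsingleton.elim (Fin.init a) Fin.elim0]
  simp

/-- The value `φ(1)` is central: `a φ(1) = φ(a) = φ(1) a`. -/
theorem hochschildD_homToCochain (B : A.RatBimod) (φ : A.homFunctor.obj B) :
    hochschildD k A.Lim B.obj 0 (A.homToCochain B φ).1 = 0 := by
  let _ : Module (EnvAlg k A.Lim) A.Lim := instModuleTensorProductMop k A.Lim
  ext a
  let φ' : ModuleCat.of (EnvAlg k A.Lim) A.Lim ⟶ B.obj := φ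
  rw [hochschildD_zero_apply, zero_apply, sub_eq_zero]
  have h1 : bimodLeft k (a 0) (φ'.hom (1 : A.Lim)) = φ'.hom (a 0) :=
    (map_smul φ'.hom _ _).symm.trans (congrArg φ'.hom (A.tmul_one_smul_one (a 0)))
  have h2 : bimodRight k (a 0) (φ'.hom (1 : A.Lim)) = φ'.hom (a 0) :=
    (map_smul φ'.hom _ _).symm.trans (congrArg φ'.hom (A.one_tmul_smul_one (a 0)))
  exact h1.trans h2.symm

/-- A cocycle of degree zero is an element `b` with `a b = b a`, and then `x ↦ x b` is a bimodule
map because `(r y s) b = r (y b) s`. -/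
theorem exists_homToCochain_eq (B : A.RatBimod) (f : A.ctnCochain B.obj 0)
    (hf : hochschildD k A.Lim B.obj 0 f.1 = 0) : ∃ φ, A.homToCochain B φ = f := by
  let _ : Module (EnvAlg k A.Lim) A.Lim := instModuleTensorProductMop k A.Lim
  let b : B.obj := f.1 Fin.elim0
  have hb : ∀ a : A.Lim, bimodLeft k a b = bimodRight k a b := fun a => by
    have := A.hochschildD_zero_apply f.1 fun _ => a
    rw [hf, zero_apply] at this
    exact (sub_eq_zero.1 this.symm)
  let φ : A.Lim →ₗ[EnvAlg k A.Lim] B.obj :=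
    { toFun := fun x => bimodLeft k x b
      map_add' := fun x y => bimodLeft_add k x y b
      map_smul' := fun x y => by
        induction x using TensorProduct.induction_on with
        | zero =>
          have h0 : (0 : EnvAlg k A.Lim) • y = 0 := zero_smul (EnvAlg k A.Lim) y
          have h1 : bimodLeft k (0 : A.Lim) b = 0 := by
            rw [bimodLeft_apply, TensorProduct.zero_tmul]
            exact zero_smul (EnvAlg k A.Lim) b
          have h2 : (0 : EnvAlg k A.Lim) • bimodLeft k y b = 0 :=
            zero_smul (EnvAlg k A.Lim) (bimodLeft k y b)
          rw [h0, h1]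
          exact h2.symm
        | add x x' hx hx' =>
          rw [add_smul, bimodLeft_add, hx, hx', ← add_smul]
          rfl
        | tmul r s =>
          have e : (r ⊗ₜ[k] s : EnvAlg k A.Lim) • y = r * y * s.unop :=
            AlgHom.mulLeftRight_apply k A.Lim r s y
          rw [e, bimodLeft_mul, hb, bimodLeft_right, bimodLeft_mul]
          rw [← bimodLeft_right]
          exact (A.tmul_smul_eq B.obj r s _).symm }
  refine ⟨(ModuleCat.ofHom φ : ModuleCat.of (EnvAlg k A.Lim) A.Lim ⟶ B.obj), ?_⟩
  refine Subtype.ext (MultilinearMap.ext fun a => ?_)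
  rw [Subsingleton.elim a Fin.elim0]
  exact bimodLeft_one k b

/-- The functor `B ↦ Hom(A, B)` is the degree zero cohomology of the continuous cochains. -/
theorem nonempty_homFunctor_iso : Nonempty (A.homFunctor ≅
    A.ctnComplexFunctor ⋙ HomologicalComplex.homologyFunctor (ModuleCat.{u} k) _ 0) := by
  let h : ∀ B : A.RatBimod, A.homFunctor.obj B ⟶ (A.ctnComplex B).X 0 := fun B =>
    ModuleCat.ofHom (A.homToCochain B)
  have hd : ∀ B, h B ≫ (A.ctnComplex B).d 0 1 = 0 := fun B => by
    rw [A.ctnComplex_d]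
    ext φ : 2
    exact Subtype.ext (A.hochschildD_homToCochain B φ)
  let c : ∀ B : A.RatBimod, A.homFunctor.obj B ⟶ (A.ctnComplex B).cycles 0 := fun B =>
    (A.ctnComplex B).liftCycles (h B) 1 (by simp) (hd B)
  have hi : ∀ B, IsIso (c B) := fun B => by
    dsimp only [c]
    -- It remains to see that `0 → Hom(A, B) → C⁰ → C¹` is exact.
    rw [CochainComplex.isIso_liftCycles_iff]
    refine ⟨(ShortComplex.moduleCat_exact_iff _).2 fun f hf => ?_,
      (ModuleCat.mono_iff_injective _).2 (A.homToCochain_injective B)⟩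
    refine A.exists_homToCochain_eq B f ?_
    have : ((A.ctnComplex B).d 0 1).hom f = 0 := hf
    rw [A.ctnComplex_d] at this
    exact congrArg Subtype.val this
  refine ⟨NatIso.ofComponents (fun B =>
    asIso (c B) ≪≫ (A.ctnComplex B).isoHomologyπ₀) fun {B B'} φ => ?_⟩
  let ψ : A.ctnComplex B ⟶ A.ctnComplex B' := A.ctnComplexFunctor.map φ
  have hn : A.homFunctor.map φ ≫ h B' = h B ≫ ψ.f 0 := rfl
  have h1 : A.homFunctor.map φ ≫ c B' = c B ≫ HomologicalComplex.cyclesMap ψ 0 := by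
    dsimp only [c]
    rw [← cancel_mono (HomologicalComplex.iCycles _ 0), Category.assoc, Category.assoc,
      HomologicalComplex.cyclesMap_i, HomologicalComplex.liftCycles_i,
      HomologicalComplex.liftCycles_i_assoc]
    exact hn
  exact (Category.assoc _ _ _).symm.trans ((congrArg (· ≫ _) h1).trans ((Category.assoc _ _ _).trans
    ((congrArg (_ ≫ ·) (HomologicalComplex.homologyπ_naturality ψ 0).symm).trans
      (Category.assoc _ _ _).symm)))

end ProfiniteAlgebra

/-! ### Contractions of a sequence with an appended last entry -/

section SnocContract

variable {R : Type*} {n : ℕ}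

theorem Fin.tail_snoc_eq (a : Fin (n + 1) → R) (x : R) :
    Fin.tail (Fin.snoc a x : Fin (n + 2) → R) = Fin.snoc (Fin.tail a) x := by
  funext i
  induction i using Fin.lastCases with
  | last => rw [Fin.snoc_last, Fin.tail, Fin.succ_last, Fin.snoc_last]
  | cast i => rw [Fin.snoc_castSucc, Fin.tail, Fin.succ_castSucc, Fin.snoc_castSucc, Fin.tail]

variable [Mul R]

theorem Fin.contractNth_snoc_castSucc (a : Fin (n + 1) → R) (x : R) (j : Fin n) :
    Fin.contractNth j.castSucc.castSucc (· * ·) (Fin.snoc a x : Fin (n + 2) → R) =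
      Fin.snoc (Fin.contractNth j.castSucc (· * ·) a) x := by
  funext i
  have hj := j.2
  induction i using Fin.lastCases with
  | last =>
    rw [Fin.snoc_last]
    simp [Fin.contractNth, Fin.snoc, hj.le.not_gt, hj.ne']
  | cast i =>
    rw [Fin.snoc_castSucc]
    simp [Fin.contractNth, Fin.snoc]
    rfl

theorem Fin.contractNth_snoc_last (a : Fin (n + 1) → R) (x : R) :
    Fin.contractNth (Fin.last n).castSucc (· * ·) (Fin.snoc a x : Fin (n + 2) → R) =
      Fin.snoc (Fin.init a) (a (Fin.last n) * x) := by
  funext i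
  induction i using Fin.lastCases with
  | last =>
    rw [Fin.snoc_last]
    simp [Fin.contractNth, Fin.snoc]
  | cast i =>
    rw [Fin.snoc_castSucc]
    simp [Fin.contractNth, Fin.snoc, Fin.init]

end SnocContract

/-! ### The bimodule of linear maps `A → B`, and vanishing on injectives -/

namespace ProfiniteAlgebra

variable {k : Type u} [Field k] (A : ProfiniteAlgebra k)

/-- The space of linear maps `A → B`, as a bimodule by `(a φ b)(x) = a φ(b x)`. -/
def CoindSpace (B : ModuleCat.{u} (EnvAlg k A.Lim)) : Type u := A.Lim →ₗ[k] B

variable (B : ModuleCat.{u} (EnvAlg k A.Lim))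

instance : AddCommGroup (A.CoindSpace B) := inferInstanceAs (AddCommGroup (A.Lim →ₗ[k] B))

/-- The action of `A` on linear maps `A → B` through `B`. -/
def coindLeft : A.Lim →ₐ[k] Module.End k (A.Lim →ₗ[k] B) :=
  AlgHom.ofLinearMap
    { toFun := fun r => LinearMap.compRight k (bimodLeft k r)
      map_add' := fun r s => by
        ext φ x
        exact bimodLeft_add k r s (φ x)
      map_smul' := fun c r => by
        ext φ x
        exact bimodLeft_smul k c r (φ x) }
    (by
      ext φ x
      exact bimodLeft_one k (φ x))
    (fun r s => by
      ext φ x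
      exact bimodLeft_mul k r s (φ x))

/-- The right action of `A` on linear maps `A → B` through left multiplication on `A`. -/
def coindRight : A.Limᵐᵒᵖ →ₐ[k] Module.End k (A.Lim →ₗ[k] B) :=
  AlgHom.ofLinearMap
    { toFun := fun s => LinearMap.lcomp k B (LinearMap.mulLeft k s.unop)
      map_add' := fun r s => by
        ext φ x
        simp [add_mul]
      map_smul' := fun c r => by
        ext φ x
        simp }
    (by
      ext φ x
      simp)
    (fun r s => by
      ext φ x
      simp)

/-- The action of `A ⊗ A^op` on linear maps `A → B`. -/
noncomputable def coindAction : EnvAlg k A.Lim →ₐ[k] Module.End k (A.Lim →ₗ[k] B) :=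
  Algebra.TensorProduct.lift (A.coindLeft B) (A.coindRight B) fun r s =>
    show A.coindLeft B r * A.coindRight B s = A.coindRight B s * A.coindLeft B r from rfl

theorem coindAction_tmul_apply (r : A.Lim) (s : A.Limᵐᵒᵖ) (φ : A.Lim →ₗ[k] B) (x : A.Lim) :
    A.coindAction B (r ⊗ₜ s) φ x = bimodLeft k r (φ (s.unop * x)) :=
  LinearMap.congr_fun (LinearMap.congr_fun (Algebra.TensorProduct.lift_tmul _ _ _ r s) φ) x

noncomputable instance : Module (EnvAlg k A.Lim) (A.CoindSpace B) :=
  letI : Module (Module.End k (A.Lim →ₗ[k] B)) (A.CoindSpace B) :=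
    inferInstanceAs (Module (Module.End k (A.Lim →ₗ[k] B)) (A.Lim →ₗ[k] B))
  Module.compHom _ (A.coindAction B).toRingHom

/-- The bimodule of linear maps `A → B`. -/
noncomputable def coind : ModuleCat.{u} (EnvAlg k A.Lim) := ModuleCat.of _ (A.CoindSpace B)

variable {B} in
/-- A linear map `A → B` as an element of the bimodule of such maps. -/
def coindMk (φ : A.Lim →ₗ[k] B) : A.coind B := φ

/-- Evaluation of linear maps `A → B` at a point. -/
noncomputable def coindEval (x : A.Lim) : A.coind B →ₗ[k] B where
  toFun φ := (show A.Lim →ₗ[k] B from φ) x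
  map_add' _ _ := rfl
  map_smul' c φ := by
    change A.coindAction B (algebraMap k _ c) φ x = _
    rw [AlgHom.commutes]
    rfl

variable {B}

theorem coindEval_tmul_smul (r : A.Lim) (s : A.Limᵐᵒᵖ) (x : A.Lim) (φ : A.coind B) :
    A.coindEval B x ((r ⊗ₜ[k] s : EnvAlg k A.Lim) • φ) =
      bimodLeft k r (A.coindEval B (s.unop * x) φ) :=
  A.coindAction_tmul_apply B r s φ x

theorem coindEval_bimodLeft (r x : A.Lim) (φ : A.coind B) :
    A.coindEval B x (bimodLeft k r φ) = bimodLeft k r (A.coindEval B x φ) := by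
  refine (A.coindEval_tmul_smul r 1 x φ).trans ?_
  rw [MulOpposite.unop_one, one_mul]

theorem coindEval_bimodRight (s x : A.Lim) (φ : A.coind B) :
    A.coindEval B x (bimodRight k s φ) = A.coindEval B (s * x) φ :=
  (A.coindEval_tmul_smul 1 (MulOpposite.op s) x φ).trans (bimodLeft_one k _)

theorem coind_ext {φ ψ : A.coind B} (h : ∀ x, A.coindEval B x φ = A.coindEval B x ψ) : φ = ψ :=
  LinearMap.ext (f := (show A.Lim →ₗ[k] B from φ)) (g := (show A.Lim →ₗ[k] B from ψ)) h

variable (B) in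
/-- The embedding `b ↦ (x ↦ b x)` of `B` into the bimodule of linear maps `A → B`. -/
noncomputable def toCoind : B →ₗ[EnvAlg k A.Lim] A.coind B where
  toFun b := A.coindMk
    { toFun := fun x => bimodRight k x b
      map_add' := fun x y => bimodRight_add k x y b
      map_smul' := fun c x => bimodRight_smul k c x b }
  map_add' b c := A.coind_ext fun x => map_add (bimodRight k x) b c
  map_smul' e b := by
    -- The image of `b` enters only through its evaluations, so the induction on `e` can run for an
    -- abstract `φ` with these evaluations.
    have key : ∀ φ : A.coind B, (∀ y, A.coindEval B y φ = bimodRight k y b) →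
        ∀ x, bimodRight k x (e • b) = A.coindEval B x (e • φ) := fun φ hφ x => by
      induction e using TensorProduct.induction_on with
      | zero =>
        have h1 : (0 : EnvAlg k A.Lim) • b = 0 := zero_smul (EnvAlg k A.Lim) b
        rw [h1, map_zero]
        exact ((congrArg (A.coindEval B x) (zero_smul (EnvAlg k A.Lim) _)).trans (map_zero _)).symm
      | add e e' h h' =>
        rw [add_smul, map_add, h, h', ← map_add, ← add_smul]
      | tmul r s =>
        rw [coindEval_tmul_smul, A.tmul_smul_eq B r s b, hφ, bimodRight_mul]
        exact (bimodLeft_right k _ _ _).symm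
    exact A.coind_ext (key _ fun _ => rfl)

theorem coindEval_toCoind (x : A.Lim) (b : B) : A.coindEval B x (A.toCoind B b) = bimodRight k x b :=
  rfl

/-- The largest rational sub-bimodule, as a rational bimodule. -/
noncomputable def rationalObj (B : ModuleCat.{u} (EnvAlg k A.Lim)) : A.RatBimod :=
  ⟨ModuleCat.of _ (A.rationalPart B), (A.isRational_iff _).2 fun b => by
    obtain ⟨α, hα⟩ := b.2
    exact ⟨α, fun x hx => Subtype.ext (hα x hx)⟩⟩

/-- The embedding of a rational bimodule `B` into the rational part of the bimodule of linear maps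
`A → B`. -/
noncomputable def toRationalCoind (B : A.RatBimod) : B ⟶ A.rationalObj (A.coind B.obj) :=
  ⟨ModuleCat.ofHom ((A.toCoind B.obj).codRestrict (A.rationalPart _) fun b => by
    obtain ⟨α, hα⟩ := (A.isRational_iff _).1 B.property b
    exact ⟨α, fun x hx => by rw [← map_smul, hα x hx, map_zero]⟩)⟩

/-- Evaluation at `1` recovers `b`; this is where the unit of `A` is needed. -/
theorem toCoind_injective : Function.Injective (A.toCoind B) := fun b c h => by
  have h1 := congrArg (A.coindEval B 1) h
  rw [coindEval_toCoind, coindEval_toCoind, bimodRight_one, bimodRight_one] at h1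
  exact h1

instance (B : A.RatBimod) : Mono (A.toRationalCoind B) := by
  have : Mono (A.isRational.ι.map (A.toRationalCoind B)) :=
    (ModuleCat.mono_iff_injective _).2 fun b c h =>
      A.toCoind_injective (congrArg Subtype.val h)
  exact A.isRational.ι.mono_of_mono_map this

/-- The cochain `a ↦ (x ↦ g(a, x))`. -/
noncomputable def curryCochain {n : ℕ} (g : HochschildCochain k A.Lim B (n + 1)) :
    HochschildCochain k A.Lim (A.coind B) n where
  toFun a := A.coindMk (g.curryRight a)
  map_update_add' a i x y := g.curryRight.map_update_add a i x y
  map_update_smul' a i c x := by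
    refine A.coind_ext fun y => ?_
    rw [map_smul]
    exact LinearMap.congr_fun (g.curryRight.map_update_smul a i c x) y

theorem coindEval_curryCochain {n : ℕ} (g : HochschildCochain k A.Lim B (n + 1))
    (a : Fin n → A.Lim) (x : A.Lim) :
    A.coindEval B x (A.curryCochain g a) = g (Fin.snoc a x) := rfl

/-- If `g` is a cocycle then `a ↦ (x ↦ g(a, x))` bounds the image of `g`, up to sign. -/
theorem hochschildD_curryCochain {n : ℕ} (g : HochschildCochain k A.Lim B (n + 1))
    (hg : hochschildD k A.Lim B (n + 1) g = 0) (a : Fin (n + 1) → A.Lim) :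
    hochschildD k A.Lim (A.coind B) n (A.curryCochain g) a = (-1 : k) ^ (n + 1) • A.toCoind B (g a) := by
  refine A.coind_ext fun x => ?_
  -- In the cocycle identity at `(a, x)`, the contraction of the last pair `aₙ x` is the right
  -- action of `aₙ` on the curried cochain, and the final term `g(a) x` is the embedded value of
  -- `g`. All other terms agree with those of the coboundary.
  have h := congrArg (fun f => f (Fin.snoc a x : Fin (n + 2) → A.Lim)) hg
  simp only [hochschildD_apply, zero_apply, Fin.tail_snoc_eq, Fin.init_snoc, Fin.snoc_last,
    Fin.sum_univ_castSucc, Fin.contractNth_snoc_castSucc, Fin.contractNth_snoc_last,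
    Fin.val_castSucc, Fin.val_last] at h
  have h0 : (Fin.snoc a x : Fin (n + 2) → A.Lim) 0 = a 0 := Fin.snoc_castSucc (α := fun _ => A.Lim) x a 0
  rw [h0] at h
  simp only [hochschildD_apply, map_add, map_sum, map_smul, coindEval_bimodLeft,
    coindEval_bimodRight, coindEval_curryCochain, coindEval_toCoind]
  rw [← sub_eq_zero, ← h, pow_succ _ (n + 1), mul_neg_one, neg_smul]
  abel

/-- The cochain `a ↦ (x ↦ g(a, x))` of a continuous cochain `g` takes rational values. -/
theorem curryCochain_mem_rationalPart (hB : A.isRational B) {n : ℕ}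
    {g : HochschildCochain k A.Lim B (n + 1)} (hg : A.IsContinuousCochain B g)
    (a : Fin n → A.Lim) : A.curryCochain g a ∈ A.rationalPart (A.coind B) := by
  obtain ⟨β, hβ⟩ := A.exists_forall_mem_level hB hg
  obtain ⟨α, hα⟩ := (A.isContinuousCochain_iff g).1 hg
  obtain ⟨γ, h1, h2⟩ := exists_ge_ge α β
  refine ⟨γ, (A.mem_level_iff (A.coind B)).1 fun r hr => ⟨A.coind_ext fun x => ?_,
    A.coind_ext fun x => ?_⟩⟩
  · rw [coindEval_bimodLeft, coindEval_curryCochain, map_zero]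
    exact (A.level_mono B h2 (hβ _) r hr).1
  -- The right action of `r` multiplies the last argument by `r`, which makes it vanish in `A_α`, so
  -- `g` takes the same value as with last argument `0`.
  · rw [coindEval_bimodRight, coindEval_curryCochain, map_zero]
    have h0 : g (Fin.snoc a 0) = 0 := g.map_coord_zero (Fin.last n) (Fin.snoc_last _ _)
    rw [← h0]
    refine hα _ _ fun i => ?_
    induction i using Fin.lastCases with
    | last =>
      rw [Fin.snoc_last, Fin.snoc_last, map_mul, A.proj_eq_of_le h1 (hr.trans (map_zero _).symm),
        map_zero, zero_mul]
    | cast i => rw [Fin.snoc_castSucc, Fin.snoc_castSucc]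

/-- Continuous cocycles in positive degree with values in an injective rational bimodule are
coboundaries of continuous cochains. -/
theorem exists_hochschildD_eq (I : A.RatBimod) [Injective I] {n : ℕ}
    (g : A.ctnCochain I.obj (n + 1)) (hg : hochschildD k A.Lim I.obj (n + 1) g.1 = 0) :
    ∃ f : A.ctnCochain I.obj n, hochschildD k A.Lim I.obj n f.1 = g.1 := by
  let K := A.rationalObj (A.coind I.obj)
  let j : I ⟶ K := A.toRationalCoind I
  -- Injectivity of `I` splits the embedding by a map of bimodules, so composing cochains with `r`
  -- commutes with the differential.
  let r : K ⟶ I := Injective.factorThru (𝟙 I) j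
  have hr : ∀ b, r.hom.hom (j.hom.hom b) = b := fun b =>
    congrArg (fun φ : I ⟶ I => φ.hom.hom b) (Injective.comp_factorThru (𝟙 I) j)
  let incl : K.obj ⟶ A.coind I.obj := ModuleCat.ofHom (A.rationalPart _).subtype
  have hincl : Function.Injective (A.bimodHomToLinear incl) := Subtype.val_injective
  have hmem := A.curryCochain_mem_rationalPart I.property g.2
  let u : HochschildCochain k A.Lim K.obj n :=
    { toFun := fun a => (⟨A.curryCochain g.1 a, hmem a⟩ : A.rationalPart (A.coind I.obj))
      map_update_add' := fun a i x y => hincl ((A.curryCochain g.1).map_update_add a i x y)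
      map_update_smul' := fun a i c x => hincl ((A.curryCochain g.1).map_update_smul a i c x) }
  have hu : hochschildMap k (AlgHom.id k A.Lim) (A.bimodHomToLinear incl) n u =
      A.curryCochain g.1 := rfl
  have hdu : ∀ a, hochschildD k A.Lim K.obj n u a = (-1 : k) ^ (n + 1) • j.hom.hom (g.1 a) :=
    fun a => by
    refine hincl ?_
    rw [map_smul]
    refine Eq.trans ?_ (A.hochschildD_curryCochain g.1 hg a)
    rw [← hu, hochschildMap_d k (A.compat_bimodHom incl)]
    rfl
  let v := hochschildMap k (AlgHom.id k A.Lim) (A.bimodHomToLinear r.hom) n u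
  have hdv : hochschildD k A.Lim I.obj n v = (-1 : k) ^ (n + 1) • g.1 := by
    ext a
    dsimp only [v]
    rw [hochschildMap_d k (A.compat_bimodHom r.hom), hochschildMap_apply]
    refine (congrArg (A.bimodHomToLinear r.hom) (hdu a)).trans ?_
    rw [map_smul]
    exact congrArg (_ • ·) (hr _)
  -- The index that works for `g` works for `v`: currying leaves the last argument fixed when the
  -- others vary.
  have hv : A.IsContinuousCochain I.obj v := by
    obtain ⟨α, hα⟩ := (A.isContinuousCochain_iff g.1).1 g.2
    refine (A.isContinuousCochain_iff v).2 ⟨α, fun a a' h => ?_⟩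
    refine congrArg (A.bimodHomToLinear r.hom) (hincl (A.coind_ext fun x => hα _ _ fun i => ?_))
    induction i using Fin.lastCases with
    | last => rw [Fin.snoc_last, Fin.snoc_last]
    | cast i =>
      rw [Fin.snoc_castSucc, Fin.snoc_castSucc]
      exact h i
  refine ⟨(-1 : k) ^ (n + 1) • ⟨v, hv⟩, ?_⟩
  refine (map_smul (hochschildD k A.Lim I.obj n) _ v).trans ?_
  rw [hdv, smul_smul, ← mul_pow, neg_one_mul, neg_neg, one_pow, one_smul]

theorem isZero_homology_ctnComplex (I : A.RatBimod) (m : ℕ) (_ : Injective I) :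
    IsZero ((A.ctnComplexFunctor.obj I).homology (m + 1)) := by
  change IsZero ((A.ctnComplex I).homology (m + 1))
  rw [← HomologicalComplex.exactAt_iff_isZero_homology,
    HomologicalComplex.exactAt_iff' _ m (m + 1) (m + 2) (by simp) (by simp),
    ShortComplex.moduleCat_exact_iff]
  intro g hg
  have hg' : ((A.ctnComplex I).d (m + 1) (m + 1 + 1)).hom g = 0 := hg
  rw [A.ctnComplex_d] at hg'
  obtain ⟨f, hf⟩ := A.exists_hochschildD_eq I g (congrArg Subtype.val hg')
  refine ⟨f, ?_⟩
  change ((A.ctnComplex I).d m (m + 1)).hom f = g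
  rw [A.ctnComplex_d]
  exact Subtype.ext hf

end ProfiniteAlgebra

/-! ### Homology of directed unions of complexes -/

section FilteredHomology

variable {k : Type u} [Field k] {J : Type u} [Preorder J] [IsDirectedOrder J] [Nonempty J]

/-- Recognizing colimits of modules over a directed order. -/
theorem ModuleCat.nonempty_isColimit_of_directed {G : J ⥤ ModuleCat.{u} k} (c : Cocone G)
    (hs : ∀ x : c.pt, ∃ j, ∃ y : G.obj j, (c.ι.app j).hom y = x)
    (hz : ∀ j (y : G.obj j), (c.ι.app j).hom y = 0 → ∃ j', ∃ h : j ⟶ j', (G.map h).hom y = 0) :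
    Nonempty (IsColimit c) := by
  refine ⟨isColimitOfReflects (forget (ModuleCat.{u} k))
    (Types.FilteredColimit.isColimitOf' _ _ (fun x => ?_) fun j x y h => ?_)⟩
  · obtain ⟨j, y, hy⟩ := hs x
    exact ⟨j, y, hy.symm⟩
  · let x' : G.obj j := x
    let y' : G.obj j := y
    have h' : (c.ι.app j).hom x' = (c.ι.app j).hom y' := h
    obtain ⟨j', f, hf⟩ := hz j (x' - y') (by rw [map_sub, h', sub_self])
    rw [map_sub, sub_eq_zero] at hf
    exact ⟨j', f, hf⟩

variable {ι : Type*} {s : ComplexShape ι}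

/-- A cycle of a complex of modules from an element killed by the differential. -/
theorem ModuleCat.exists_iCycles_eq (K : HomologicalComplex (ModuleCat.{u} k) s) {i j : ι}
    (hj : s.next i = j) (x : K.X i) (hx : (K.d i j).hom x = 0) :
    ∃ z : K.cycles i, (K.iCycles i).hom z = x := by
  have h : (ShortComplex.mk _ _ (K.iCycles_d i j)).Exact :=
    ShortComplex.exact_of_f_is_kernel _ (K.cyclesIsKernel i j hj)
  exact (ShortComplex.moduleCat_exact_iff _).1 h x hx

theorem ModuleCat.iCycles_injective (K : HomologicalComplex (ModuleCat.{u} k) s) (i : ι) :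
    Function.Injective (K.iCycles i).hom :=
  (ModuleCat.mono_iff_injective _).1 inferInstance

theorem ModuleCat.homologyπ_surjective (K : HomologicalComplex (ModuleCat.{u} k) s) (i : ι) :
    Function.Surjective (K.homologyπ i).hom :=
  (ModuleCat.epi_iff_surjective _).1 inferInstance

/-- Homology is the cokernel of `toCycles`, so the kernel of `homologyπ` is the image of `toCycles`;
injectivity of `iCycles` moves the equation from cycles to chains. -/
theorem ModuleCat.homologyπ_eq_zero_iff (K : HomologicalComplex (ModuleCat.{u} k) s) {i j : ι}
    (hi : s.prev j = i) (z : K.cycles j) :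
    (K.homologyπ j).hom z = 0 ↔ ∃ w : K.X i, (K.d i j).hom w = (K.iCycles j).hom z := by
  have h : (ShortComplex.mk _ _ (K.toCycles_comp_homologyπ i j)).Exact :=
    ShortComplex.exact_of_g_is_cokernel _ (K.homologyIsCokernel i j hi)
  have hw : ∀ w, (K.iCycles j).hom ((K.toCycles i j).hom w) = (K.d i j).hom w := fun w =>
    congrArg (fun φ : K.X i ⟶ K.X j => φ.hom w) (K.toCycles_i i j)
  constructor
  · intro hz
    obtain ⟨w, rfl⟩ := (ShortComplex.moduleCat_exact_iff _).1 h z hz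
    exact ⟨w, (hw w).symm⟩
  · rintro ⟨w, h'⟩
    rw [← hw] at h'
    rw [← ModuleCat.iCycles_injective K j h']
    exact congrArg (fun φ : K.X i ⟶ K.homology j => φ.hom w) (K.toCycles_comp_homologyπ i j)

/-- The homology of a directed union of complexes of modules is the colimit of the homologies. -/
theorem ModuleCat.nonempty_isColimit_homology {G : J ⥤ HomologicalComplex (ModuleCat.{u} k) s}
    (c : Cocone G) (hs : ∀ i (x : c.pt.X i), ∃ j, ∃ y : (G.obj j).X i, ((c.ι.app j).f i).hom y = x)
    (hi : ∀ i j, Function.Injective ((c.ι.app j).f i).hom) (i : ι) :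
    Nonempty (IsColimit
      ((HomologicalComplex.homologyFunctor (ModuleCat.{u} k) s i).mapCocone c)) := by
  have hcyc : ∀ {K L : HomologicalComplex (ModuleCat.{u} k) s} (φ : K ⟶ L) (z : K.cycles i),
      (L.iCycles i).hom ((HomologicalComplex.cyclesMap φ i).hom z) =
        (φ.f i).hom ((K.iCycles i).hom z) := fun {K L} φ z =>
    congrArg (fun ψ : K.cycles i ⟶ L.X i => ψ.hom z) (HomologicalComplex.cyclesMap_i φ i)
  have hhom : ∀ {K L : HomologicalComplex (ModuleCat.{u} k) s} (φ : K ⟶ L) (z : K.cycles i),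
      (HomologicalComplex.homologyMap φ i).hom ((K.homologyπ i).hom z) =
        (L.homologyπ i).hom ((HomologicalComplex.cyclesMap φ i).hom z) := fun {K L} φ z =>
    congrArg (fun ψ : K.cycles i ⟶ L.homology i => ψ.hom z)
      (HomologicalComplex.homologyπ_naturality φ i)
  have hd : ∀ {K L : HomologicalComplex (ModuleCat.{u} k) s} (φ : K ⟶ L) (i j : ι) (x : K.X i),
      (L.d i j).hom ((φ.f i).hom x) = (φ.f j).hom ((K.d i j).hom x) := fun {K L} φ i j x =>
    congrArg (fun ψ : K.X i ⟶ L.X j => ψ.hom x) (φ.comm i j)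
  have hw : ∀ {j j' : J} (h : j ⟶ j') (l : ι) (x : (G.obj j).X l),
      ((c.ι.app j').f l).hom (((G.map h).f l).hom x) = ((c.ι.app j).f l).hom x := fun {j j'} h l x =>
    congrArg (fun φ : G.obj j ⟶ c.pt => (φ.f l).hom x) (c.w h)
  refine ModuleCat.nonempty_isColimit_of_directed _ (fun x => ?_) fun j y hy => ?_
  · obtain ⟨z, rfl⟩ := ModuleCat.homologyπ_surjective c.pt i x
    obtain ⟨j, y, hy⟩ := hs i ((c.pt.iCycles i).hom z)
    -- The representative `y` is already a cycle at stage `j`, because the map to the union is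
    -- injective in the next degree too.
    have hdy : ((G.obj j).d i (s.next i)).hom y = 0 := by
      refine hi _ j ?_
      rw [← hd, hy, map_zero]
      exact congrArg (fun φ : c.pt.cycles i ⟶ c.pt.X (s.next i) => φ.hom z) (c.pt.iCycles_d i _)
    obtain ⟨z', hz'⟩ := ModuleCat.exists_iCycles_eq (G.obj j) rfl y hdy
    refine ⟨j, ((G.obj j).homologyπ i).hom z', (hhom (c.ι.app j) z').trans (congrArg _ ?_)⟩
    refine ModuleCat.iCycles_injective c.pt i ?_
    rw [hcyc, hz', hy]
  · obtain ⟨z, rfl⟩ := ModuleCat.homologyπ_surjective (G.obj j) i y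
    have hy' : (c.pt.homologyπ i).hom ((HomologicalComplex.cyclesMap (c.ι.app j) i).hom z) = 0 :=
      (hhom (c.ι.app j) z).symm.trans hy
    obtain ⟨w, h⟩ := (ModuleCat.homologyπ_eq_zero_iff c.pt rfl _).1 hy'
    obtain ⟨l, w', rfl⟩ := hs _ w
    -- The cycle lives at stage `j` and the chain bounding it at stage `l`; at a common later stage
    -- `m`, injectivity into the union makes the bounding relation hold already there.
    obtain ⟨m, hjm, hlm⟩ := exists_ge_ge j l
    refine ⟨m, homOfLE hjm, (hhom (G.map (homOfLE hjm)) z).trans ?_⟩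
    refine (ModuleCat.homologyπ_eq_zero_iff (G.obj m) rfl _).2
      ⟨((G.map (homOfLE hlm)).f _).hom w', hi _ m ?_⟩
    refine (hd _ _ _ _).symm.trans ((congrArg (c.pt.d _ i).hom (hw _ _ _)).trans (h.trans ?_))
    rw [hcyc, hcyc]
    exact (hw (homOfLE hjm) i ((G.obj j).iCycles i |>.hom z)).symm

end FilteredHomology

/-! ### Continuous cochains as a directed union, and the theorem -/

namespace ProfiniteAlgebra

variable {k : Type u} [Field k] (A : ProfiniteAlgebra k)

/-- A continuous cochain comes from a cochain of some `A_α` with values in `B^α`. -/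
theorem exists_levelCocone_eq (B : A.RatBimod) {n : ℕ} (f : A.ctnCochain B.obj n) :
    ∃ (α : A.Index) (g : HochschildCochain k (A.obj α) (A.level B.obj α) n),
      hochschildMap k (A.proj α) (A.levelSubtype B.obj α) n g = f.1 := by
  obtain ⟨β, hβ⟩ := A.exists_forall_mem_level B.property f.2
  obtain ⟨α, hα⟩ := (A.isContinuousCochain_iff f.1).1 f.2
  obtain ⟨γ, h1, h2⟩ := exists_ge_ge α β
  -- The section `s` is only linear, and its choice is immaterial: `f` depends on its arguments only
  -- through `A_α`, and `γ` dominates `α`. Since `γ` also dominates `β`, the values lie in `B^γ`.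
  obtain ⟨s, hs⟩ := (A.proj γ).toLinearMap.exists_rightInverse_of_surjective
    (LinearMap.range_eq_top.2 (A.proj_surjective γ))
  let f' : HochschildCochain k (A.obj γ) B.obj n := f.1.compLinearMap fun _ => s
  refine ⟨γ, f'.codRestrict ((A.level B.obj γ).restrictScalars k) fun a =>
    A.level_mono B.obj h2 (hβ _), ?_⟩
  ext a
  exact hα _ _ fun i => A.proj_eq_of_le h1 (LinearMap.congr_fun hs (A.proj γ (a i)))

/-- A cochain on `A_α` is determined by its pullback to `A`, since `A → A_α` is surjective, and `B^α
→ B` is injective. -/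
theorem levelCocone_injective (B : A.RatBimod) (n : ℕ) (α : A.Index) :
    Function.Injective (hochschildMap k (A.proj α) (A.levelSubtype B.obj α) n) := by
  intro f g h
  ext a
  choose a' ha' using fun i => A.proj_surjective α (a i)
  have := congrArg (fun f => f a') h
  simp only [hochschildMap_apply, ha'] at this
  exact this

/-- The cohomology of the continuous cochains is the colimit of the cohomologies of the `A_α`. -/
theorem nonempty_isColimit_levelCocone (B : A.RatBimod) (n : ℕ) : Nonempty (IsColimit
    ((HomologicalComplex.homologyFunctor (ModuleCat.{u} k) _ n).mapCocone (A.levelCocone B))) := by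
  refine ModuleCat.nonempty_isColimit_homology _ (fun i f => ?_) (fun i α f g h => ?_) n
  · obtain ⟨α, g, hg⟩ := A.exists_levelCocone_eq B f
    exact ⟨α, g, Subtype.ext hg⟩
  · exact A.levelCocone_injective B i α (congrArg Subtype.val h)

end ProfiniteAlgebra

theorem mainTheorem5 {k : Type u} [Field k] (A : ProfiniteAlgebra k) (n : ℕ) :
    ∃ e : A.ctnCohomology n ≅
        A.ctnComplexFunctor ⋙ HomologicalComplex.homologyFunctor (ModuleCat.{u} k) _ n,
      ∀ B : A.RatBimod, Nonempty (IsColimit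
        (((HomologicalComplex.homologyFunctor (ModuleCat.{u} k) _ n).mapCocone
          (A.levelCocone B)).extend (e.inv.app B))) := by
  obtain ⟨e₀⟩ := A.nonempty_homFunctor_iso
  obtain ⟨e⟩ := nonempty_rightDerived_iso_homology A.ctnComplexFunctor
    A.ctnComplexFunctor_shortExact A.isZero_homology_ctnComplex A.homFunctor e₀ n
  refine ⟨e, fun B => ?_⟩
  obtain ⟨h⟩ := A.nonempty_isColimit_levelCocone B n
  have he : IsIso (e.inv.app B) := inferInstance
  -- Any choice of `e` serves: a colimit cocone stays a colimit cocone when its point is changed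
  -- along an isomorphism.
  exact ⟨@IsColimit.extendIso _ _ _ _ _ _ _ (e.inv.app B) he h⟩
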